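/- Let $(\Omega,\Sigma,P)$ be a probability space. A counting process is a family $N=\{N_t\}_{t\ge 0}$ of $\overline{\mathbb R}$-valued random variables on $\Omega$ with values in $\mathbb N_0\cup\{\infty\}$, all of whose paths are right-continuous and nondecreasing, have jumps of size at most one, start from $N_0=0$ and tend to $\infty$. Its arrival times are $T_n=\inf\{t\ge 0: N_t=n\}$ $(n\ge 0)$ and its interarrival times are $W_n=T_n-T_{n-1}$ $(n\ge 1)$. For a random variable $\Theta$, the law of $\Theta$ is denoted by $P_\Theta$. A disintegration of $P$ over a probability measure $\mu$ on a measurable space $Y$ is a family $\{Q_y\}_{y\in Y}$ of probability measures on $\Sigma$ such that $y\mapsto Q_y(E)$ is measurable and $\int Q_y(E)\,\mu(dy)=P(E)$ for every $E\in\Sigma$. If $\mu=P_\Theta$ for some $\Theta:\Omega\to Y$, it is consistent with $\Theta$ if, for every measurable $B\subseteq Y$, $Q_y(\Theta^{-1}(B))=1$ for $\mu$-a.a. $y\in B$. For $\theta>0$ and a probability measure $Q$ on $\Sigma$, $N$ is a $Q$-$PP(\theta)$ if under $Q$ it has independent and stationary increments and $N_t$ is Poisson distributed with parameter $\theta t$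 for all $t>0$. Here stationarity means that for all $0=t_0<\dots<t_m$ and $s>0$ the vectors $(N_{t_j+s}-N_{t_{j-1}+s})_{j\le m}$ and $(N_{t_j}-N_{t_{j-1}})_{j\le m}$ have the same law. * $N$ is a $P$-MPP$(\Theta)$, where $\Theta$ is a real-valued random variable with $P_\Theta((0,\infty))=1$, if conditionally given $\Theta$ it has independent and stationary increments (independence and equality of the laws above being understood conditionally on $\sigma(\Theta)$), and for every $t>0$ the conditional distribution of $N_t$ given $\Theta$ is $P$-a.s. the Poisson law with parameter $\Theta t$. * Let $\{P_y\}_{y\in Y}$ be a family of probability measures on $\Sigma$, indexed by a set $Y$, and $\nu$ a probability measure on the $\sigma$-algebra $B(\Sigma)$ on $Y$ generated by the maps $y\mapsto P_y(E)$, $E\in\Sigma$. $N$ is a $P$-MPP$(\{P_y\},\nu)$ if $P(\bigcap_{k=1}^r\{W_k\le w_k\})=\int\prod_{k=1}^r P_y(\{W_k\le w_k\})\,\nu(dy)$ for all $r\in\mathbb N$ and $w_1,\dots,w_r>0$, and there is a positive $B(\Sigma)$-measurable function $\alpha$ on $Y$ such that, for $\nu$-a.a. $y$, the $W_n$ are $P_y$-independent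 and exponentially distributed with parameter $\alpha(y)$ under $P_y$. * $N$ is a $P$-MPP$(U)$, where $U$ is a distribution on the Borel sets of $\mathbb R$ with $U((0,\infty))=1$, if for all $m\in\mathbb N$, $0=t_0<t_1<\dots<t_m$ and $\kappa_1,\dots,\kappa_m\in\mathbb N_0$ $$P\Bigl(\bigcap_{j=1}^m\{N_{t_j}-N_{t_{j-1}}=\kappa_j\}\Bigr)=\int_{(0,\infty)}\prod_{j=1}^m e^{-\theta(t_j-t_{j-1})}\frac{(\theta(t_j-t_{j-1}))^{\kappa_j}}{\kappa_j!}\,U(d\theta).$$ Assumption (A) on $N$: there are a Borel set $D\subseteq\mathbb R$, a random variable $\Theta:\Omega\to D$, a measurable $h:D\to\mathbb R$, probability measures $\mathbf K(h(\theta))$ on $\mathbb R$, $\theta\in D$, with $\theta\mapsto\mathbf K(h(\theta))(B)$ measurable for every Borel set $B$, and a disintegration $\{P_\theta\}_{\theta\in D}$ of $P$ over $P_\Theta$ consistent with $\Theta$, such that the $W_n$ are conditionally independent given $\Theta$, each with conditional distribution $\mathbf K(h(\Theta))$ given $\Theta$ a.s., and such that there are a $P_\Theta$-null Borel set $L\subseteq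 D$ and a function $C\in\mathcal L^1(P_{h(\Theta)})$ for which the following holds: for every $\theta\in D\setminus L$ and every $n$ the function $F_\theta(t)=P_\theta(\{W_n\le t\})$ is continuously differentiable on $(0,\infty)$, $0<F_\theta'(t)<C(h(\theta))$ for all $t>0$, the limit $p(\theta)=\lim_{t\downarrow 0}F_\theta'(t)$ exists, does not depend on $n$ and is positive, and $p$ is injective on $D\setminus L$. **Theorem.** For a counting process $N$ consider the assertions: (i) there is a real-valued random variable $\check\Theta$ such that $N$ is a $P$-MPP$(\check\Theta)$; (ii) there are a family $\{P_y\}_{y\in Y}$ of probability measures on $\Sigma$ and a probability measure $\nu$ on $B(\Sigma)$ such that $N$ is a $P$-MPP$(\{P_y\},\nu)$; (iii) there are a real-valued random variable $\check\Theta$ and a disintegration $\{Q_\theta\}_{\theta\in\mathbb R}$ of $P$ over $P_{\check\Theta}$ consistent with $\check\Theta$ such that $N$ is a $Q_\theta$-$PP(\theta)$ for $P_{\check\Theta}$-a.a. $\theta\in\mathbb R$ (in particular $\theta>0$ for a.a. $\theta$); (iv) there is a distribution $U$ on the Borel sets of $\mathbb R$ with $U((0,\infty))=1$ such that $N$ is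 a $P$-MPP$(U)$. Then (iii) $\Rightarrow$ (i) $\Rightarrow$ (iv). If $P$ is perfect (for every measurable $f:\Omega\to\mathbb R$ there is a Borel set $B\subseteq f(\Omega)$ with $P(f^{-1}(B))=1$) and $\Sigma$ is countably generated, then (i) $\Leftrightarrow$ (iii) and (i) $\Rightarrow$ (ii). If, in addition, Assumption (A) holds, then (i)–(iv) are all equivalent. -/

import Mathlib

open MeasureTheory ProbabilityTheory Filter Topology Set
open scoped NNReal ENNReal

universe u v

noncomputable section

namespace MixedPoisson

/-! Perfect measures and disintegrations. -/

/-- A probability measure `P` is perfect if for every real-valued measurable `f` the image of `f`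
contains a Borel set of full `P ∘ f⁻¹`-measure. -/
def IsPerfect {Ω : Type u} [MeasurableSpace Ω] (P : Measure Ω) : Prop :=
  ∀ f : Ω → ℝ, Measurable f → ∃ B : Set ℝ, MeasurableSet B ∧ B ⊆ range f ∧ P (f ⁻¹' B) = 1

/-- `{Q y}` is a family of probability measures which is a disintegration of `P` over `μ`. -/
structure IsDisintegration {Ω : Type u} [MeasurableSpace Ω] {Y : Type v} [MeasurableSpace Y]
    (Q : Y → Measure Ω) (P : Measure Ω) (μ : Measure Y) : Prop where
  prob : ∀ y, IsProbabilityMeasure (Q y)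
  measurable : ∀ E : Set Ω, MeasurableSet E → Measurable fun y => Q y E
  lintegral_eq : ∀ E : Set Ω, MeasurableSet E → ∫⁻ y, Q y E ∂μ = P E

/-- The disintegration `Q` over `μ` is consistent with `Θ`. -/
def IsConsistent {Ω : Type u} [MeasurableSpace Ω] {Y : Type v} [MeasurableSpace Y]
    (Q : Y → Measure Ω) (μ : Measure Y) (Θ : Ω → Y) : Prop :=
  ∀ B : Set Y, MeasurableSet B → ∀ᵐ y ∂μ, y ∈ B → Q y (Θ ⁻¹' B) = 1

/-! Conditional notions with respect to a random element `Θ`. -/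

/-- The σ-algebra generated by `Θ`. -/
abbrev sigmaOf {Ω : Type u} {Y : Type v} [MeasurableSpace Y] (Θ : Ω → Y) : MeasurableSpace Ω :=
  MeasurableSpace.comap Θ inferInstance

/-- Conditional independence given `Θ` of a family of random variables, through the conditional
probabilities of the sets `{X i ≤ x i}`, over all finite subfamilies. -/
def CondIndepFamily {Ω : Type u} [MeasurableSpace Ω] {Y : Type v} [MeasurableSpace Y]
    {ι E : Type*} [LE E] (P : Measure Ω) (Θ : Ω → Y) (X : ι → Ω → E) : Prop :=
  ∀ (s : Finset ι) (x : ι → E),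
    P⟦⋂ i ∈ s, {ω | X i ω ≤ x i} | sigmaOf Θ⟧ =ᵐ[P]
      fun ω => ∏ i ∈ s, (P⟦{ω' | X i ω' ≤ x i} | sigmaOf Θ⟧) ω

/-- `X` and `X'` have the same conditional distribution given `Θ`. -/
def CondIdentDistrib {Ω : Type u} [MeasurableSpace Ω] {Y : Type v} [MeasurableSpace Y]
    {E : Type*} [MeasurableSpace E] (P : Measure Ω) (Θ : Ω → Y) (X X' : Ω → E) : Prop :=
  ∀ F : Set Ω, MeasurableSet[sigmaOf Θ] F → ∀ B : Set E, MeasurableSet B →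
    P (F ∩ X ⁻¹' B) = P (F ∩ X' ⁻¹' B)

/-- The conditional distribution of `X` given `Θ` is `K (Θ)`, almost surely: `ω ↦ K (Θ ω) B` is a
version of the conditional probability of `X⁻¹(B)` given `Θ`, for every measurable `B`. -/
def HasCondLaw {Ω : Type u} [MeasurableSpace Ω] {Y : Type v} [MeasurableSpace Y]
    {E : Type*} [MeasurableSpace E] (P : Measure Ω) (X : Ω → E) (Θ : Ω → Y)
    (K : Y → Measure E) : Prop :=
  ∀ B : Set E, MeasurableSet B →
    P⟦X ⁻¹' B | sigmaOf Θ⟧ =ᵐ[P] fun ω => (K (Θ ω)).real B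

/-! Counting processes, their arrival and interarrival processes. -/

/-- Counting processes. The exceptional null set is taken to be empty. In the condition on the
jumps the supremum over `s < t` is the left limit at `t` of the (nondecreasing) path. -/
structure IsCountingProcess {Ω : Type u} [MeasurableSpace Ω] (N : ℝ≥0 → Ω → EReal) : Prop where
  measurable : ∀ t, Measurable (N t)
  values : ∀ t ω, (∃ k : ℕ, N t ω = (k : EReal)) ∨ N t ω = ⊤
  zero : ∀ ω, N 0 ω = 0
  monotone : ∀ ω, Monotone fun t => N t ω
  right_continuous : ∀ ω t, ContinuousWithinAt (fun s => N s ω) (Ici t) t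
  jump_le_one : ∀ ω t, 0 < t → N t ω ≤ (⨆ s : Iio t, N s ω) + 1
  tendsto_top : ∀ ω, Tendsto (fun t => N t ω) atTop (𝓝 ⊤)

/-- The arrival times `T n = inf {t | N t = n}`, `n = 0, 1, 2, …`. -/
def arrival {Ω : Type u} (N : ℝ≥0 → Ω → EReal) (n : ℕ) (ω : Ω) : ℝ :=
  ((sInf {t : ℝ≥0 | N t ω = (n : EReal)} : ℝ≥0) : ℝ)

/-- The interarrival times, indexed from `0`: `interarrival N n` is `T (n + 1) - T n`, the
`(n + 1)`-st interarrival time. -/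
def interarrival {Ω : Type u} (N : ℝ≥0 → Ω → EReal) (n : ℕ) (ω : Ω) : ℝ :=
  arrival N (n + 1) ω - arrival N n ω

/-- The partition `0 = t 0 < t 1 < ⋯ < t m`. -/
def IsPartition {m : ℕ} (t : Fin (m + 1) → ℝ≥0) : Prop :=
  t 0 = 0 ∧ StrictMono t

/-- The vector of increments `N (t j + h) - N (t (j - 1) + h)`, `j = 1, …, m`. In `EReal` one has
`⊤ - ⊤ = ⊥`, which is never equal to a natural number. -/
def increments {Ω : Type u} (N : ℝ≥0 → Ω → EReal) {m : ℕ} (t : Fin (m + 1) → ℝ≥0) (h : ℝ≥0)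
    (ω : Ω) (j : Fin m) : EReal :=
  N (t j.succ + h) ω - N (t j.castSucc + h) ω

/-- The Poisson law with parameter `r ≥ 0`, as a law on the extended real line. -/
def poissonLaw (r : ℝ) : Measure EReal :=
  (poissonMeasure r.toNNReal).map fun k : ℕ => (k : EReal)

/-! Poisson processes and the three kinds of mixed Poisson processes. -/

/-- `N` is a Poisson process with parameter `θ > 0` with respect to `P`: independent and
stationary increments, and `N t` has the Poisson law with parameter `θ t` for `t > 0`. -/
structure IsPoissonProcess {Ω : Type u} [MeasurableSpace Ω] (P : Measure Ω)
    (N : ℝ≥0 → Ω → EReal) (θ : ℝ) : Prop where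
  pos : 0 < θ
  indep : ∀ (m : ℕ) (t : Fin (m + 1) → ℝ≥0), IsPartition t →
    iIndepFun (fun j ω => increments N t 0 ω j) P
  stationary : ∀ (m : ℕ) (t : Fin (m + 1) → ℝ≥0), IsPartition t → ∀ h : ℝ≥0, 0 < h →
    P.map (increments N t h) = P.map (increments N t 0)
  law : ∀ t : ℝ≥0, 0 < t → P.map (N t) = poissonLaw (θ * t)

/-- `N` is a mixed Poisson process with mixing parameter the real-valued random variable `Θ`. -/
structure IsMPPParameter {Ω : Type u} [MeasurableSpace Ω] (P : Measure Ω)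
    (N : ℝ≥0 → Ω → EReal) (Θ : Ω → ℝ) : Prop where
  measurable : Measurable Θ
  pos : P.map Θ (Ioi 0) = 1
  cond_indep : ∀ (m : ℕ) (t : Fin (m + 1) → ℝ≥0), IsPartition t →
    CondIndepFamily P Θ (fun j ω => increments N t 0 ω j)
  cond_stationary : ∀ (m : ℕ) (t : Fin (m + 1) → ℝ≥0), IsPartition t → ∀ h : ℝ≥0, 0 < h →
    CondIdentDistrib P Θ (increments N t h) (increments N t 0)
  cond_law : ∀ t : ℝ≥0, 0 < t → HasCondLaw P (N t) Θ fun θ => poissonLaw (θ * t)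

/-- The smallest σ-algebra on the index set `Y` for which all the maps `y ↦ Q y E`, `E` measurable,
are measurable. -/
@[reducible]
def familySigma {Ω : Type u} [MeasurableSpace Ω] {Y : Type v} (Q : Y → Measure Ω) :
    MeasurableSpace Y :=
  ⨆ (E : Set Ω) (_ : MeasurableSet E), MeasurableSpace.comap (fun y => Q y E) inferInstance

/-- `N` is a mixed Poisson process associated with the family `{Q y}` of probability measures and
with the probability measure `ν` on the σ-algebra generated by the family. -/
structure IsMPPFamily {Ω : Type u} [MeasurableSpace Ω] (P : Measure Ω) (N : ℝ≥0 → Ω → EReal)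
    {Y : Type v} (Q : Y → Measure Ω) (ν : @Measure Y (familySigma Q)) : Prop where
  prob : ∀ y, IsProbabilityMeasure (Q y)
  prob_mixing : ν univ = 1
  mixture : ∀ (r : ℕ) (w : Fin r → ℝ), (∀ k, 0 < w k) →
    P (⋂ k : Fin r, {ω | interarrival N k ω ≤ w k}) =
      ∫⁻ y, ∏ k : Fin r, Q y {ω | interarrival N k ω ≤ w k} ∂ν
  exponential : ∃ α : Y → ℝ, (∀ y, 0 < α y) ∧ Measurable[familySigma Q] α ∧
    ∀ᵐ y ∂ν, iIndepFun (interarrival N) (Q y) ∧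
      ∀ n, (Q y).map (interarrival N n) = expMeasure (α y)

/-- `N` is a mixed Poisson process with mixing distribution `U`, a distribution on the real line
which is concentrated on `(0, ∞)`. -/
structure IsMPPDistribution {Ω : Type u} [MeasurableSpace Ω] (P : Measure Ω)
    (N : ℝ≥0 → Ω → EReal) (U : Measure ℝ) : Prop where
  prob : IsProbabilityMeasure U
  pos : U (Ioi 0) = 1
  mixture : ∀ (m : ℕ) (t : Fin (m + 1) → ℝ≥0), IsPartition t → ∀ κ : Fin m → ℕ,
    P.real (⋂ j : Fin m, {ω | N (t j.succ) ω - N (t j.castSucc) ω = (κ j : EReal)}) =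
      ∫ θ in Ioi (0 : ℝ), ∏ j : Fin m,
        (Real.exp (-θ * ((t j.succ : ℝ) - t j.castSucc)) *
          (θ * ((t j.succ : ℝ) - t j.castSucc)) ^ κ j / (κ j).factorial) ∂U

/-! The structural assumption on the counting process. -/

/-- `N` is an extended mixed renewal process with mixing parameters `Θ` and `h` and interarrival
time conditional distribution `K (h (Θ))`. The random variable `Θ` has its values in the set `D`.
Only the distributions `K (h θ)`, `θ ∈ D`, matter. -/
structure IsExtendedMRP {Ω : Type u} [MeasurableSpace Ω] (P : Measure Ω) (N : ℝ≥0 → Ω → EReal)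
    {D : Set ℝ} (Θ : Ω → D) (h : D → ℝ) (K : ℝ → Measure ℝ) : Prop where
  measurable_param : Measurable Θ
  measurable_h : Measurable h
  prob : ∀ θ : D, IsProbabilityMeasure (K (h θ))
  measurable_K : ∀ B : Set ℝ, MeasurableSet B → Measurable fun θ : D => K (h θ) B
  cond_indep : CondIndepFamily P Θ (interarrival N)
  cond_law : ∀ n, HasCondLaw P (interarrival N n) Θ fun θ => K (h θ)

/-- The regularity of the distribution functions `F θ (t) = R θ {W n ≤ t}` of the interarrival
times under the measures of the disintegration `{R θ}`, outside of a null set `L`: they are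
continuously differentiable on `(0, ∞)` with a positive derivative dominated by an integrable
function of `h θ`, and the limit `p θ` of the derivative at `0` is positive and injective in `θ`. -/
def IsRegular {Ω : Type u} [MeasurableSpace Ω] (P : Measure Ω) (N : ℝ≥0 → Ω → EReal)
    {D : Set ℝ} (Θ : Ω → D) (h : D → ℝ) (R : D → Measure Ω) : Prop :=
  ∃ (L : Set D) (C : ℝ → ℝ) (p : D → ℝ),
    MeasurableSet L ∧ P.map Θ L = 0 ∧
    Integrable C (P.map fun ω => h (Θ ω)) ∧
    (∀ θ ∉ L, ∀ n : ℕ,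
      ContDiffOn ℝ 1 (fun t : ℝ => (R θ).real {ω | interarrival N n ω ≤ t}) (Ioi 0) ∧
      (∀ t : ℝ, 0 < t →
        0 < deriv (fun t : ℝ => (R θ).real {ω | interarrival N n ω ≤ t}) t ∧
        deriv (fun t : ℝ => (R θ).real {ω | interarrival N n ω ≤ t}) t < C (h θ)) ∧
      Tendsto (deriv fun t : ℝ => (R θ).real {ω | interarrival N n ω ≤ t}) (𝓝[>] 0) (𝓝 (p θ))) ∧
    (∀ θ ∉ L, 0 < p θ) ∧ InjOn p Lᶜ

/-- There are a Borel set `D`, a real-valued random variable `Θ` with values in `D` and a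
disintegration of `P` over the law of `Θ`, consistent with `Θ`, such that `N` is an extended mixed
renewal process with regular interarrival distributions. -/
def RenewalAssumption {Ω : Type u} [MeasurableSpace Ω] (P : Measure Ω) (N : ℝ≥0 → Ω → EReal) :
    Prop :=
  ∃ (D : Set ℝ) (Θ : Ω → D) (h : D → ℝ) (K : ℝ → Measure ℝ) (R : D → Measure Ω),
    MeasurableSet D ∧ IsExtendedMRP P N Θ h K ∧
    IsDisintegration R P (P.map Θ) ∧ IsConsistent R (P.map Θ) Θ ∧ IsRegular P N Θ h R

/-! The four assertions about a counting process. -/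

/-- `N` is a mixed Poisson process with some mixing parameter. -/
def HasMixingParameter {Ω : Type u} [MeasurableSpace Ω] (P : Measure Ω) (N : ℝ≥0 → Ω → EReal) :
    Prop :=
  ∃ Θ : Ω → ℝ, IsMPPParameter P N Θ

/-- `N` is a mixed Poisson process associated with some family of probability measures, indexed by
some set of the universe `v`, and some probability measure on the σ-algebra it generates. -/
def HasMixingFamily {Ω : Type u} [MeasurableSpace Ω] (P : Measure Ω) (N : ℝ≥0 → Ω → EReal) :
    Prop :=
  ∃ (Y : Type v) (Q : Y → Measure Ω) (ν : @Measure Y (familySigma Q)), IsMPPFamily P N Q ν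

/-- There are a real-valued random variable `Θ` and a disintegration `{Q θ}` of `P` over its law,
consistent with `Θ`, such that `N` is a Poisson process with parameter `θ` under `Q θ`, for almost
all `θ`. -/
def HasPoissonDisintegration {Ω : Type u} [MeasurableSpace Ω] (P : Measure Ω)
    (N : ℝ≥0 → Ω → EReal) : Prop :=
  ∃ (Θ : Ω → ℝ) (Q : ℝ → Measure Ω), Measurable Θ ∧ IsDisintegration Q P (P.map Θ) ∧
    IsConsistent Q (P.map Θ) Θ ∧ ∀ᵐ θ ∂(P.map Θ), IsPoissonProcess (Q θ) N θ

/-- `N` is a mixed Poisson process with some mixing distribution. -/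
def HasMixingDistribution {Ω : Type u} [MeasurableSpace Ω] (P : Measure Ω)
    (N : ℝ≥0 → Ω → EReal) : Prop :=
  ∃ U : Measure ℝ, IsMPPDistribution P N U

end MixedPoisson

end

/-! All four assertions are read off the law of the sequence W of interarrival times. If W is i.i.d.
exponential of rate θ (law `expSeq θ`), conditioning on the first arrival shows that the counts over
disjoint intervals are independent Poisson variables (`expSeq_counts`). Conversely, since T_n ≤ t if
and only if n ≤ N_t, the increments at rational times determine the law of the arrival times
(`ext_of_counts`). Hence N has mixed Poisson increments with mixing distribution U exactly when W
has the law `mixLaw U`; a Dirac mass for U gives the Poisson process itself.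

(iii) ⇒ (i) reads the conditional probabilities given Θ off the disintegration. For (i) ⇒ (iv),
conditional independence, stationarity and the Poisson law give the increment formula on every event
{Θ ∈ C}, and C = ℝ is the claim. If P is perfect and Σ countably generated, regular conditional
probabilities given Θ exist (`IsPerfect.exists_disintegrates`). Outside one null set they satisfy
the countably many increment identities at rational times, so W has law `expSeq θ` under almost
every one of them. This is (iii), and the same measures form the family in (ii).

Under (A), each of (ii) and (iv) says that W has law `mixLaw U` under P, while the renewal property
makes W a mixture of i.i.d. sequences with marginals K(h(θ)). With G_θ the tail of K(h(θ)), the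
P_Θ-integrals of G(s+t)², G(s+t)G(s)G(t) and G(s)²G(t)² are joint tail probabilities of two, three
and four interarrival times, and for a mixture of exponentials they coincide. So G_θ(s+t) =
G_θ(s)G_θ(t) for almost all θ (`ae_memoryless_of_mixture`), K(h(θ)) is exponential, and its rate,
evaluated at Θ, is the required mixing parameter. -/

namespace MixedPoisson

/-! ### Uniqueness for laws of real sequences -/

/-- Finite measures on sequences of reals which agree on the sets of sequences with finitely many
coordinates bounded by rational numbers are equal. -/
theorem ext_of_forall_iInter_le {μ ν : Measure (ℕ → ℝ)} [IsFiniteMeasure μ]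
    (h : ∀ (s : Finset ℕ) (q : ℕ → ℚ),
      μ (⋂ k ∈ s, {x | x k ≤ q k}) = ν (⋂ k ∈ s, {x | x k ≤ q k})) : μ = ν := by
  let π : ℕ → Set (Set (ℕ → ℝ)) := fun k => ⋃ a : ℚ, {{x | x k ≤ (a : ℝ)}}
  have hπ : ∀ k, IsPiSystem (π k) := by
    rintro k A hA B hB -
    simp only [π, mem_iUnion, mem_singleton_iff] at hA hB ⊢
    obtain ⟨a, rfl⟩ := hA
    obtain ⟨b, rfl⟩ := hB
    refine ⟨min a b, ?_⟩
    ext x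
    simp
  have hgen : (MeasurableSpace.pi : MeasurableSpace (ℕ → ℝ)) =
      MeasurableSpace.generateFrom (piiUnionInter π univ) := by
    apply le_antisymm
    · refine iSup_le fun k => ?_
      rw [show (fun _ : ℕ => Real.measurableSpace) k = borel ℝ from BorelSpace.measurable_eq,
        Real.borel_eq_generateFrom_Iic_rat, MeasurableSpace.comap_generateFrom]
      refine MeasurableSpace.generateFrom_mono ?_
      rintro _ ⟨A, hA, rfl⟩
      simp only [mem_iUnion, mem_singleton_iff] at hA
      obtain ⟨a, rfl⟩ := hA
      exact subset_piiUnionInter (mem_univ k) (by simp only [π, mem_iUnion]; exact ⟨a, rfl⟩)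
    · refine MeasurableSpace.generateFrom_le ?_
      rintro _ ⟨s, -, f, hf, rfl⟩
      refine Finset.measurableSet_biInter _ fun k hk => ?_
      have := hf k hk
      simp only [π, mem_iUnion, mem_singleton_iff] at this
      obtain ⟨a, ha⟩ := this
      rw [ha]
      exact measurableSet_le (measurable_pi_apply k) measurable_const
  refine ext_of_generate_finite _ hgen (isPiSystem_piiUnionInter π hπ univ) ?_ ?_
  · rintro _ ⟨s, -, f, hf, rfl⟩
    have : ∀ k ∈ s, ∃ a : ℚ, f k = {x | x k ≤ (a : ℝ)} := fun k hk => by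
      simpa only [π, mem_iUnion, mem_singleton_iff] using hf k hk
    choose! q hq using this
    have e : (⋂ k ∈ s, f k) = ⋂ k ∈ s, {x : ℕ → ℝ | x k ≤ q k} :=
      iInter₂_congr hq
    rw [e, h]
  -- The empty intersection compares the total masses.
  · simpa using h ∅ 0

/-- Variant of `ext_of_forall_iInter_le` with initial segments of coordinates only. -/
theorem ext_of_forall_iInter_fin_le {μ ν : Measure (ℕ → ℝ)} [IsFiniteMeasure μ]
    (h : ∀ (r : ℕ) (w : Fin r → ℝ),
      μ (⋂ k : Fin r, {x | x k ≤ w k}) = ν (⋂ k : Fin r, {x | x k ≤ w k})) : μ = ν := by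
  refine ext_of_forall_iInter_le fun s q => ?_
  obtain ⟨r, hr⟩ : ∃ r, ∀ k ∈ s, k < r := ⟨s.sup id + 1, fun k hk =>
    Nat.lt_succ_of_le (Finset.le_sup (f := id) hk)⟩
  -- Coordinates below `r` but outside `s` get the bound `M`; letting `M` increase removes it by
  -- continuity from below.
  let A : ℕ → Set (ℕ → ℝ) := fun M =>
    ⋂ k : Fin r, {x | x k ≤ if (k : ℕ) ∈ s then (q k : ℝ) else M}
  have hA : (⋂ k ∈ s, {x : ℕ → ℝ | x k ≤ q k}) = ⋃ M, A M := by
    ext x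
    simp only [mem_iInter, mem_ofPred_eq, mem_iUnion, A]
    constructor
    · intro hx
      obtain ⟨M, hM⟩ := exists_nat_ge (∑ k : Fin r, |x k|)
      refine ⟨M, fun k => ?_⟩
      split_ifs with hk
      · exact hx _ hk
      · exact (le_abs_self _).trans ((Finset.single_le_sum (f := fun k : Fin r => |x k|)
          (fun _ _ => abs_nonneg _) (Finset.mem_univ k)).trans hM)
    · rintro ⟨M, hM⟩ k hk
      simpa [hk] using hM ⟨k, hr k hk⟩
  have hmono : Monotone A := by
    intro M M' hMM' x hx
    simp only [mem_iInter, mem_ofPred_eq, A] at hx ⊢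
    intro k
    refine (hx k).trans ?_
    split_ifs
    · exact le_rfl
    · exact_mod_cast hMM'
  rw [hA, hmono.measure_iUnion, hmono.measure_iUnion]
  exact iSup_congr fun M => h r _

/-! ### Count events for arrival sequences and their behaviour under shifts -/

/-- Partial sums of a sequence. -/
def psum (w : ℕ → ℝ) (n : ℕ) : ℝ := ∑ i ∈ Finset.range n, w i

@[simp] theorem psum_zero (w : ℕ → ℝ) : psum w 0 = 0 := by simp [psum]

theorem psum_succ (w : ℕ → ℝ) (n : ℕ) : psum w (n + 1) = psum w n + w n :=
  Finset.sum_range_succ _ _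

theorem measurable_psum : Measurable psum :=
  measurable_pi_lambda _ fun _ => Finset.measurable_sum _ fun i _ => measurable_pi_apply i

/-- The sequence starting with `u` and continued by `w`. -/
def seqCons (u : ℝ) (w : ℕ → ℝ) : ℕ → ℝ
  | 0 => u
  | n + 1 => w n

theorem measurable_seqCons : Measurable fun p : ℝ × (ℕ → ℝ) => seqCons p.1 p.2 := by
  refine measurable_pi_lambda _ fun n => ?_
  cases n with
  | zero => exact measurable_fst
  | succ n => exact (measurable_pi_apply n).comp measurable_snd

theorem psum_seqCons (u : ℝ) (w : ℕ → ℝ) (n : ℕ) : psum (seqCons u w) (n + 1) = u + psum w n := by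
  rw [psum, Finset.sum_range_succ', add_comm]
  rfl

/-- The set of sequences `x` of arrival times for which there are `n` arrivals up to time `t` and
`k` further arrivals in each of the consecutive intervals of length `d`, for `(d, k)` in the list.
The condition on the first `n` arrivals is not part of the definition. -/
def counts : ℝ → ℕ → List (ℝ × ℕ) → Set (ℕ → ℝ)
  | _, _, [] => univ
  | t, n, p :: l =>
    {x | x (n + p.2) ≤ t + p.1 ∧ t + p.1 < x (n + p.2 + 1)} ∩ counts (t + p.1) (n + p.2) l

theorem measurableSet_counts (l : List (ℝ × ℕ)) (t : ℝ) (n : ℕ) :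
    MeasurableSet (counts t n l) := by
  induction l generalizing t n with
  | nil => exact MeasurableSet.univ
  | cons p l ih =>
    exact ((measurableSet_le (measurable_pi_apply _) measurable_const).inter
      (measurableSet_lt measurable_const (measurable_pi_apply _))).inter (ih _ _)

/-- Once the first arrival at `u` has been counted, it can be deleted: indices drop by one and all
times are measured from `u`. -/
theorem psum_seqCons_mem_counts_succ (l : List (ℝ × ℕ)) (u t : ℝ) (n : ℕ) (w : ℕ → ℝ) :
    psum (seqCons u w) ∈ counts t (n + 1) l ↔ psum w ∈ counts (t - u) n l := by
  induction l generalizing t n with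
  | nil => simp [counts]
  | cons p l ih =>
    simp only [counts, mem_inter_iff, mem_ofPred_eq]
    rw [show n + 1 + p.2 = n + p.2 + 1 by ring, ih, psum_seqCons, psum_seqCons,
      show t + p.1 - u = t - u + p.1 by ring]
    refine and_congr (and_congr ?_ ?_) Iff.rfl <;> constructor <;> intro h <;> linarith

/-- As long as no arrival has been counted, the time origin may be moved by `d`, which only changes
the first interarrival time. This is the pathwise half of the loss of memory. The signs matter
because with no arrivals the event also contains the condition that the zeroth arrival time, which
is 0, has passed. At the first positive count both sides reduce to `psum_seqCons_mem_counts_succ`.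
-/
theorem psum_seqCons_mem_counts_zero (l : List (ℝ × ℕ)) (hl : ∀ p ∈ l, 0 ≤ p.1) (u t d : ℝ)
    (ht : 0 ≤ t) (hd : 0 ≤ d) (w : ℕ → ℝ) :
    psum (seqCons u w) ∈ counts (t + d) 0 l ↔ psum (seqCons (u - d) w) ∈ counts t 0 l := by
  induction l generalizing t with
  | nil => simp [counts]
  | cons p l ih =>
    have hp : 0 ≤ p.1 := hl p (by simp)
    have hl' : ∀ p ∈ l, 0 ≤ p.1 := fun q hq => hl q (by simp [hq])
    obtain ⟨e, k⟩ := p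
    cases k with
    | zero =>
      simp only [counts, mem_inter_iff, mem_ofPred_eq, add_zero, psum_zero]
      rw [show t + d + e = t + e + d by ring, ih hl' _ (by positivity), psum_seqCons, psum_seqCons]
      simp only [psum_zero, add_zero]
      refine and_congr (and_congr ⟨fun _ => by positivity, fun _ => by positivity⟩ ?_) Iff.rfl
      constructor <;> intro h <;> linarith
    | succ k =>
      simp only [counts, mem_inter_iff, mem_ofPred_eq, zero_add]
      rw [psum_seqCons_mem_counts_succ, psum_seqCons_mem_counts_succ, psum_seqCons, psum_seqCons,
        psum_seqCons, psum_seqCons, show t + d + e - u = t + e - (u - d) by ring]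
      refine and_congr (and_congr ?_ ?_) Iff.rfl <;> constructor <;> intro h <;> linarith

/-! ### Poisson weights and sequences of independent exponential variables -/

/-- The probability that a Poisson process with parameter `θ` has exactly `k` points in an interval
of length `d`. -/
noncomputable def poissonWeight (θ d : ℝ) (k : ℕ) : ℝ :=
  Real.exp (-θ * d) * (θ * d) ^ k / k.factorial

theorem poissonWeight_nonneg {θ d : ℝ} (hθ : 0 ≤ θ) (hd : 0 ≤ d) (k : ℕ) :
    0 ≤ poissonWeight θ d k := by
  unfold poissonWeight; positivity

/-- The product of the Poisson weights over a list. -/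
noncomputable def listWeight (θ : ℝ) (l : List (ℝ × ℕ)) : ℝ :=
  (l.map fun p => poissonWeight θ p.1 p.2).prod

theorem listWeight_cons (θ : ℝ) (p : ℝ × ℕ) (l : List (ℝ × ℕ)) :
    listWeight θ (p :: l) = poissonWeight θ p.1 p.2 * listWeight θ l := by
  simp [listWeight]

/-- The law of a sequence of independent exponential random variables with parameter `θ`. -/
noncomputable def expSeq (θ : ℝ) : Measure (ℕ → ℝ) := Measure.infinitePi fun _ => expMeasure θ

theorem isProbabilityMeasure_expSeq {θ : ℝ} (hθ : 0 < θ) : IsProbabilityMeasure (expSeq θ) := by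
  have := isProbabilityMeasure_expMeasure hθ
  unfold expSeq
  infer_instance

/-- Prepending an independent copy to an i.i.d. sequence gives an i.i.d. sequence; on a cylinder the
factor at index 0 splits off. This is what permits conditioning on the first interarrival time. -/
theorem map_seqCons {ν : Measure ℝ} [IsProbabilityMeasure ν] :
    (ν.prod (Measure.infinitePi fun _ : ℕ => ν)).map (fun p => seqCons p.1 p.2) =
      Measure.infinitePi fun _ : ℕ => ν := by
  refine Measure.eq_infinitePi _ fun s t ht => ?_
  have hm : MeasurableSet (Set.pi (s : Set ℕ) t) :=
    MeasurableSet.pi s.countable_toSet fun i _ => ht i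
  rw [Measure.map_apply measurable_seqCons hm]
  -- The nonzero indices of `s`, shifted down by one.
  let s' : Finset ℕ := (s.erase 0).image Nat.pred
  have hs' : ∀ n, n ∈ s' ↔ n + 1 ∈ s := by
    intro n
    simp only [s', Finset.mem_image, Finset.mem_erase]
    constructor
    · rintro ⟨a, ⟨h0, ha⟩, rfl⟩
      rwa [← Nat.succ_eq_add_one, Nat.succ_pred h0]
    · exact fun h => ⟨n + 1, ⟨by simp, h⟩, rfl⟩
  have e : (fun p : ℝ × (ℕ → ℝ) => seqCons p.1 p.2) ⁻¹' (Set.pi (s : Set ℕ) t) =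
      (if 0 ∈ s then t 0 else univ) ×ˢ (Set.pi (s' : Set ℕ) fun n => t (n + 1)) := by
    ext ⟨u, w⟩
    simp only [mem_preimage, Set.mem_pi, Finset.mem_coe, mem_prod]
    constructor
    · intro h
      refine ⟨?_, fun n hn => h (n + 1) ((hs' n).1 hn)⟩
      split_ifs with h0
      · exact h 0 h0
      · trivial
    · rintro ⟨h0, h1⟩ n hn
      cases n with
      | zero => rwa [if_pos (Finset.mem_coe.1 hn)] at h0
      | succ n => exact h1 n ((hs' n).2 hn)
  rw [e, Measure.prod_prod, Measure.infinitePi_pi _ fun i _ => ht _]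
  have e2 : ∏ i ∈ s', ν (t (i + 1)) = ∏ i ∈ s.erase 0, ν (t i) := by
    rw [Finset.prod_image]
    · refine Finset.prod_congr rfl fun i hi => ?_
      rw [← Nat.succ_eq_add_one, Nat.succ_pred (Finset.ne_of_mem_erase hi)]
    · intro a ha b hb hab
      have h1 := Finset.ne_of_mem_erase (Finset.mem_coe.1 ha)
      have h2 := Finset.ne_of_mem_erase (Finset.mem_coe.1 hb)
      exact Nat.pred_inj (Nat.pos_of_ne_zero h1) (Nat.pos_of_ne_zero h2) hab
  rw [e2]
  split_ifs with h0
  · rw [Finset.mul_prod_erase _ (fun i => ν (t i)) h0]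
  · rw [measure_univ, one_mul, Finset.erase_eq_of_notMem h0]

end MixedPoisson

/-! ### Exponential interarrival times yield independent Poisson counts -/

namespace MixedPoisson

theorem lintegral_expMeasure (θ : ℝ) {f : ℝ → ℝ≥0∞} (hf : Measurable f) :
    ∫⁻ x, f x ∂(expMeasure θ) =
      ∫⁻ x in Ioi 0, ENNReal.ofReal (θ * Real.exp (-(θ * x))) * f x := by
  have h1 : expMeasure θ = volume.withDensity (exponentialPDF θ) := rfl
  have h2 : Measurable (exponentialPDF θ) := (measurable_exponentialPDFReal θ).ennreal_ofReal
  rw [h1, lintegral_withDensity_eq_lintegral_mul _ h2 hf, restrict_Ioi_eq_restrict_Ici,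
    ← lintegral_indicator measurableSet_Ici]
  refine lintegral_congr fun x => ?_
  rw [Pi.mul_apply, exponentialPDF_eq]
  by_cases hx : 0 ≤ x
  · rw [indicator_of_mem (mem_Ici.2 hx), if_pos hx]
  · rw [indicator_of_notMem (by simpa using hx), if_neg hx]
    simp

/-- Loss of memory in integrated form: translation by `d` multiplies the density by the factor
exp(-θd). -/
theorem setLIntegral_expMeasure_Ioi (θ : ℝ) {d : ℝ} (hd : 0 ≤ d) {H : ℝ → ℝ≥0∞}
    (hH : Measurable H) :
    ∫⁻ x in Ioi d, H (x - d) ∂(expMeasure θ) =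
      ENNReal.ofReal (Real.exp (-θ * d)) * ∫⁻ x, H x ∂(expMeasure θ) := by
  have hm : Measurable fun x => H (x - d) := hH.comp (measurable_id.sub_const d)
  have hp : Measurable fun x : ℝ => ENNReal.ofReal (θ * Real.exp (-(θ * x))) := by fun_prop
  rw [← lintegral_indicator measurableSet_Ioi,
    lintegral_expMeasure θ (hm.indicator measurableSet_Ioi), lintegral_expMeasure θ hH,
    ← lintegral_indicator measurableSet_Ioi, ← lintegral_indicator measurableSet_Ioi,
    ← lintegral_const_mul (f := (Ioi 0).indicator fun x =>
      ENNReal.ofReal (θ * Real.exp (-(θ * x))) * H x) _ ((hp.mul hH).indicator measurableSet_Ioi),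
    ← lintegral_add_right_eq_self _ d]
  refine lintegral_congr fun x => ?_
  by_cases hx : 0 < x
  · rw [indicator_of_mem (mem_Ioi.2 (by linarith)), indicator_of_mem (mem_Ioi.2 (by linarith)),
      indicator_of_mem (mem_Ioi.2 hx), add_sub_cancel_right, ← mul_assoc,
      ← ENNReal.ofReal_mul (Real.exp_pos _).le]
    congr 2
    rw [show -(θ * (x + d)) = -θ * d + -(θ * x) by ring, Real.exp_add]
    ring
  · rw [indicator_of_notMem (s := Ioi 0) (a := x) (by simpa using hx)]
    by_cases hx' : 0 < x + d
    · rw [indicator_of_mem (mem_Ioi.2 hx'), indicator_of_notMem (by simpa using hx)]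
      simp
    · rw [indicator_of_notMem (by simpa using hx')]
      simp

theorem poissonWeight_zero (θ d : ℝ) : poissonWeight θ d 0 = Real.exp (-θ * d) := by
  simp [poissonWeight]

theorem measurable_poissonWeight_left (d : ℝ) (k : ℕ) :
    Measurable fun θ => poissonWeight θ d k := by
  unfold poissonWeight; fun_prop

/-- First-arrival decomposition of `k + 1` arrivals. The two exponentials multiply to the constant
exp(-θd), which leaves a power of `d - u` with an explicit antiderivative. -/
theorem integral_exp_mul_poissonWeight (θ d : ℝ) (k : ℕ) :
    ∫ u in (0)..d, θ * Real.exp (-(θ * u)) * poissonWeight θ (d - u) k =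
      poissonWeight θ d (k + 1) := by
  have hk : ((k + 1).factorial : ℝ) ≠ 0 := by positivity
  have hk' : (k.factorial : ℝ) ≠ 0 := by positivity
  have hderiv : ∀ u ∈ uIcc 0 d, HasDerivAt
      (fun u => -(Real.exp (-θ * d) * (θ * (d - u)) ^ (k + 1) / (k + 1).factorial))
      (θ * Real.exp (-(θ * u)) * poissonWeight θ (d - u) k) u := by
    intro u _
    have h1 : HasDerivAt (fun u => θ * (d - u)) (θ * (-1)) u :=
      ((hasDerivAt_id u).const_sub d).const_mul θ
    have h2 := (((h1.pow (k + 1)).const_mul (Real.exp (-θ * d))).div_const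
      ((k + 1).factorial : ℝ)).neg
    refine h2.congr_deriv ?_
    rw [poissonWeight, show -θ * d = -(θ * u) + -θ * (d - u) by ring, Real.exp_add,
      Nat.factorial_succ]
    push_cast
    field_simp
  rw [intervalIntegral.integral_eq_sub_of_hasDerivAt hderiv]
  · simp [poissonWeight]
  · refine Continuous.intervalIntegrable ?_ _ _
    unfold poissonWeight
    fun_prop

theorem setLIntegral_poissonWeight {θ : ℝ} (hθ : 0 < θ) {d : ℝ} (hd : 0 ≤ d) (k : ℕ) :
    ∫⁻ u in Iic d, ENNReal.ofReal (poissonWeight θ (d - u) k) ∂(expMeasure θ) =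
      ENNReal.ofReal (poissonWeight θ d (k + 1)) := by
  have hc : Continuous fun u => poissonWeight θ (d - u) k := by unfold poissonWeight; fun_prop
  rw [← lintegral_indicator measurableSet_Iic,
    lintegral_expMeasure θ (hc.measurable.ennreal_ofReal.indicator measurableSet_Iic),
    ← integral_exp_mul_poissonWeight, intervalIntegral.integral_of_le hd,
    ofReal_integral_eq_lintegral_ofReal]
  · rw [← lintegral_indicator measurableSet_Ioi, ← lintegral_indicator measurableSet_Ioc]
    refine lintegral_congr fun x => ?_
    by_cases hx : 0 < x
    · by_cases hx' : x ≤ d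
      · rw [indicator_of_mem (mem_Ioi.2 hx), indicator_of_mem (mem_Iic.2 hx'),
          indicator_of_mem (mem_Ioc.2 ⟨hx, hx'⟩),
          ENNReal.ofReal_mul (p := θ * Real.exp (-(θ * x))) (by positivity)]
      · simp [hx', indicator]
    · simp [hx, indicator]
  · refine Continuous.integrableOn_Ioc ?_
    fun_prop
  · refine (ae_restrict_iff' measurableSet_Ioc).2 (ae_of_all _ fun u hu => ?_)
    have := poissonWeight_nonneg hθ.le (sub_nonneg.2 hu.2) k
    simp only [Pi.zero_apply]
    positivity

theorem expMeasure_Iic_zero (θ : ℝ) : expMeasure θ (Iic 0) = 0 := by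
  rw [← lintegral_indicator_one measurableSet_Iic,
    lintegral_expMeasure θ (measurable_one.indicator measurableSet_Iic),
    setLIntegral_congr_fun (g := fun _ => 0) measurableSet_Ioi]
  · simp
  · intro x hx
    have : ¬ x ≤ 0 := not_le.2 hx
    simp [indicator, this]

theorem expMeasure_Ioi {θ : ℝ} (hθ : 0 < θ) {t : ℝ} (ht : 0 ≤ t) :
    expMeasure θ (Ioi t) = ENNReal.ofReal (Real.exp (-θ * t)) := by
  have := isProbabilityMeasure_expMeasure hθ
  have h := setLIntegral_expMeasure_Ioi θ ht (H := fun _ => 1) measurable_const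
  simpa using h

theorem ae_expSeq_pos {θ : ℝ} (hθ : 0 < θ) : ∀ᵐ w ∂(expSeq θ), ∀ n, 0 < w n := by
  have := isProbabilityMeasure_expMeasure hθ
  refine ae_all_iff.2 fun n => ?_
  have h := (measurePreserving_eval_infinitePi (fun _ : ℕ => expMeasure θ) n)
  have h0 : ∀ᵐ u ∂(expMeasure θ), 0 < u := by
    rw [ae_iff]
    simpa [Iic_def] using expMeasure_Iic_zero θ
  exact h.quasiMeasurePreserving.ae h0

theorem psum_nonneg {w : ℕ → ℝ} (hw : ∀ n, 0 < w n) (n : ℕ) : 0 ≤ psum w n :=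
  Finset.sum_nonneg fun i _ => (hw i).le

/-- Conditioning on the first interarrival time, by `map_seqCons` and Fubini. -/
theorem expSeq_apply {θ : ℝ} (hθ : 0 < θ) {A : Set (ℕ → ℝ)} (hA : MeasurableSet A) :
    expSeq θ A = ∫⁻ u, expSeq θ {w | seqCons u w ∈ A} ∂(expMeasure θ) := by
  have := isProbabilityMeasure_expMeasure hθ
  have := isProbabilityMeasure_expSeq hθ
  conv_lhs => rw [expSeq, ← map_seqCons]
  rw [Measure.map_apply measurable_seqCons hA, Measure.prod_apply (measurable_seqCons hA)]
  rfl

theorem measurable_expSeq_seqCons {θ : ℝ} (hθ : 0 < θ) {A : Set (ℕ → ℝ)} (hA : MeasurableSet A) :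
    Measurable fun u => expSeq θ {w | seqCons u w ∈ A} := by
  have := isProbabilityMeasure_expSeq hθ
  exact measurable_measure_prodMk_left (measurable_seqCons hA)

/-- The counting process of a renewal process with exponential interarrival times has independent
increments with Poisson laws. -/
theorem expSeq_counts {θ : ℝ} (hθ : 0 < θ) (l : List (ℝ × ℕ)) (hl : ∀ p ∈ l, 0 ≤ p.1) :
    expSeq θ {w | psum w ∈ counts 0 0 l} = ENNReal.ofReal (listWeight θ l) := by
  have := isProbabilityMeasure_expSeq hθ
  have hmeas : ∀ l, MeasurableSet {w | psum w ∈ counts 0 0 l} := fun l =>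
    measurable_psum (measurableSet_counts l 0 0)
  induction l with
  | nil => simp [counts, listWeight]
  | cons p l ih =>
    obtain ⟨d, k⟩ := p
    have hd : 0 ≤ d := hl (d, k) (by simp)
    have hl' : ∀ p ∈ l, 0 ≤ p.1 := fun q hq => hl q (by simp [hq])
    have ih := ih hl'
    clear hl
    -- A first arrival at `u` turns the pair `(d, k + 1)` into `(d - u, k)`, so the inner induction
    -- must cover all lengths `d`.
    induction k generalizing d with
    | zero =>
      -- No arrival up to `d` means `d < u`; the rest of the event is then that of a first arrival
      -- at `u - d`, which the loss of memory makes exponential again.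
      have key : ∀ u, expSeq θ {w | psum (seqCons u w) ∈ counts 0 0 ((d, 0) :: l)} =
          (Ioi d).indicator
            (fun u => expSeq θ {w | psum (seqCons (u - d) w) ∈ counts 0 0 l}) u := by
        intro u
        have e : {w | psum (seqCons u w) ∈ counts 0 0 ((d, 0) :: l)} =
            {w | d < u ∧ psum (seqCons (u - d) w) ∈ counts 0 0 l} := by
          ext w
          have := psum_seqCons_mem_counts_zero l hl' u 0 d le_rfl hd w
          simp only [counts, mem_inter_iff, mem_ofPred_eq, add_zero, psum_zero, psum_seqCons,
            zero_add] at this ⊢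
          rw [this]
          tauto
        rw [e]
        by_cases hu : d < u
        · simp [hu]
        · simp [hu]
      rw [expSeq_apply hθ (hmeas _)]
      simp only [mem_ofPred_eq]
      simp_rw [key]
      rw [lintegral_indicator measurableSet_Ioi, setLIntegral_expMeasure_Ioi θ hd
        (H := fun u => expSeq θ {w | psum (seqCons u w) ∈ counts 0 0 l})
        (measurable_expSeq_seqCons hθ (hmeas l)), listWeight_cons,
        ENNReal.ofReal_mul (poissonWeight_nonneg hθ.le hd _), ← ih, poissonWeight_zero,
        expSeq_apply hθ (hmeas l)]
      rfl
    | succ k ihk =>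
      have key : ∀ u, expSeq θ {w | psum (seqCons u w) ∈ counts 0 0 ((d, k + 1) :: l)} =
          (Iic d).indicator (fun u => ENNReal.ofReal (poissonWeight θ (d - u) k) *
            ENNReal.ofReal (listWeight θ l)) u := by
        intro u
        have e : {w | psum (seqCons u w) ∈ counts 0 0 ((d, k + 1) :: l)} =
            {w | psum w ∈ counts 0 0 ((d - u, k) :: l)} := by
          ext w
          simp only [counts, mem_inter_iff, mem_ofPred_eq, zero_add, psum_seqCons,
            psum_seqCons_mem_counts_succ]
          refine and_congr (and_congr ?_ ?_) Iff.rfl <;> constructor <;> intro h <;> linarith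
        rw [e]
        by_cases hu : u ≤ d
        · rw [ihk (d - u) (sub_nonneg.2 hu), indicator_of_mem (mem_Iic.2 hu), listWeight_cons,
            ENNReal.ofReal_mul (poissonWeight_nonneg hθ.le (sub_nonneg.2 hu) _)]
        · rw [indicator_of_notMem (by simpa using hu)]
          -- With `d < u` the event would force a partial sum of `w` to be at most `d - u`, hence
          -- negative.
          refine measure_mono_null ?_ (ae_iff.1 (ae_expSeq_pos hθ))
          intro w hw hpos
          have h1 := psum_nonneg hpos k
          simp only [counts, mem_inter_iff, mem_ofPred_eq, zero_add] at hw
          linarith [hw.1.1]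
      have hc : Continuous fun u => poissonWeight θ (d - u) k := by
        unfold poissonWeight; fun_prop
      rw [expSeq_apply hθ (hmeas _)]
      simp only [mem_ofPred_eq]
      simp_rw [key]
      rw [lintegral_indicator measurableSet_Iic,
        lintegral_mul_const _ hc.measurable.ennreal_ofReal,
        setLIntegral_poissonWeight hθ hd, listWeight_cons,
        ENNReal.ofReal_mul (poissonWeight_nonneg hθ.le hd _)]

end MixedPoisson

/-! ### Counts on rational grids determine the law of the arrival times -/

namespace MixedPoisson

/-- The list of consecutive intervals of length `h` with the given numbers of points. -/
def gridList (h : ℝ) (l : List ℕ) : List (ℝ × ℕ) := l.map fun k => (h, k)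

theorem exists_between_of_unbounded {x : ℕ → ℝ} (hx : StrictMono x) (hunb : ∀ t, ∃ n, t < x n)
    {t : ℝ} {n : ℕ} (hn : x n ≤ t) : ∃ k, x (n + k) ≤ t ∧ t < x (n + k + 1) := by
  by_contra! hcon
  obtain ⟨N, hN⟩ := hunb t
  have hall : ∀ k, x (n + k) ≤ t := by
    intro k
    induction k with
    | zero => exact hn
    | succ k ih => exact hcon k ih
  rcases le_total n N with h | h
  · obtain ⟨k, rfl⟩ := Nat.exists_eq_add_of_le h
    exact absurd (hall k) (not_le.2 hN)
  · exact absurd ((hx.monotone h).trans hn) (not_le.2 hN)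

theorem exists_mem_counts_gridList {x : ℕ → ℝ} (hx : StrictMono x) (hunb : ∀ t, ∃ n, t < x n)
    {h : ℝ} (hh : 0 ≤ h) (M : ℕ) {t : ℝ} {n : ℕ} (hn : x n ≤ t) :
    ∃ l : List ℕ, l.length = M ∧ x ∈ counts t n (gridList h l) := by
  induction M generalizing t n with
  | zero => exact ⟨[], rfl, trivial⟩
  | succ M ih =>
    obtain ⟨k, hk⟩ := exists_between_of_unbounded hx hunb (hn.trans (le_add_of_nonneg_right hh))
    obtain ⟨l, hl, hxl⟩ := ih hk.1
    exact ⟨k :: l, by simp [hl], ⟨hk, hxl⟩⟩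

theorem between_unique {x : ℕ → ℝ} (hx : StrictMono x) {t : ℝ} {m n : ℕ}
    (hm : x m ≤ t ∧ t < x (m + 1)) (hn : x n ≤ t ∧ t < x (n + 1)) : m = n := by
  have h1 := hx.lt_iff_lt.1 (hm.1.trans_lt hn.2)
  have h2 := hx.lt_iff_lt.1 (hn.1.trans_lt hm.2)
  omega

theorem gridList_unique {x : ℕ → ℝ} (hx : StrictMono x) {h : ℝ} {l l' : List ℕ}
    (hl : l.length = l'.length) {t : ℝ} {n : ℕ} (h1 : x ∈ counts t n (gridList h l))
    (h2 : x ∈ counts t n (gridList h l')) : l = l' := by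
  induction l generalizing l' t n with
  | nil => exact (List.length_eq_zero_iff.1 hl.symm).symm
  | cons a l ih =>
    cases l' with
    | nil => simp at hl
    | cons b l' =>
      have hab : a = b := by
        exact Nat.add_left_cancel (between_unique hx h1.1 h2.1)
      subst hab
      rw [ih (by simpa using hl) h1.2 h2.2]

theorem le_iff_of_between {x : ℕ → ℝ} (hx : StrictMono x) {t : ℝ} {n : ℕ}
    (hn : x n ≤ t ∧ t < x (n + 1)) (k : ℕ) : x k ≤ t ↔ k ≤ n := by
  constructor
  · intro hk
    exact Nat.lt_succ_iff.1 (hx.lt_iff_lt.1 (hk.trans_lt hn.2))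
  · exact fun hk => (hx.monotone hk).trans hn.1

/-- The count up to a grid point decides which arrivals have occurred by then. Two sequences with
the same counts in all grid cells therefore have their arrivals on the same side of every grid
point. -/
theorem le_iff_le_of_mem_counts {x y : ℕ → ℝ} (hx : StrictMono x) (hy : StrictMono y) {h : ℝ}
    {l : List ℕ} {t : ℝ} {n : ℕ} (hxn : x n ≤ t ∧ t < x (n + 1)) (hyn : y n ≤ t ∧ t < y (n + 1))
    (hxl : x ∈ counts t n (gridList h l)) (hyl : y ∈ counts t n (gridList h l)) {c : ℕ}
    (hc : c ≤ l.length) (k : ℕ) : x k ≤ t + c * h ↔ y k ≤ t + c * h := by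
  induction c generalizing l t n with
  | zero =>
    simp only [Nat.cast_zero, zero_mul, add_zero]
    rw [le_iff_of_between hx hxn, le_iff_of_between hy hyn]
  | succ c ih =>
    cases l with
    | nil => simp at hc
    | cons a l =>
      have := ih hxl.1 hyl.1 hxl.2 hyl.2 (by simpa using hc)
      simp only at this
      push_cast
      rwa [show t + h + c * h = t + (c + 1) * h by ring] at this

/-- The law of a strictly increasing sequence of arrival times is determined by the finite
dimensional distributions of the increments of the counting process at rational times. -/
theorem ext_of_counts {μ ν : Measure (ℕ → ℝ)} [IsProbabilityMeasure μ] [IsProbabilityMeasure ν]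
    (hμ : ∀ᵐ x ∂μ, x 0 = 0 ∧ StrictMono x) (hν : ∀ᵐ x ∂ν, x 0 = 0 ∧ StrictMono x)
    (hsum : ∀ n : ℕ, 0 < n → ∑' k, ν (counts 0 0 [((n : ℝ), k)]) = 1)
    (h : ∀ l : List (ℝ × ℕ), (∀ p ∈ l, ∃ q : ℚ, 0 < q ∧ p.1 = q) →
      μ (counts 0 0 l) = ν (counts 0 0 l)) : μ = ν := by
  let G : Set (ℕ → ℝ) := {x | (x 0 = 0 ∧ StrictMono x) ∧ ∀ t, ∃ n, t < x n}
  -- Arrival times are unbounded almost surely because the disjoint events of having exactly `k`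
  -- arrivals up to time `n` exhaust the total mass.
  have hgood : ∀ ρ : Measure (ℕ → ℝ), IsProbabilityMeasure ρ →
      (∀ᵐ x ∂ρ, x 0 = 0 ∧ StrictMono x) →
      (∀ n : ℕ, 0 < n → ∑' k, ρ (counts 0 0 [((n : ℝ), k)]) = 1) → ∀ᵐ x ∂ρ, x ∈ G := by
    intro ρ _ hρ hs
    have h1 : ∀ᵐ x ∂ρ, ∀ n : ℕ, x ∈ ⋃ k, counts 0 0 [(((n + 1 : ℕ) : ℝ), k)] := by
      refine ae_all_iff.2 fun n => ?_
      have hm : ∀ k, MeasurableSet (counts 0 0 [(((n + 1 : ℕ) : ℝ), k)]) := fun k =>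
        measurableSet_counts _ _ _
      refine (mem_ae_iff_prob_eq_one (MeasurableSet.iUnion hm)).2 ?_
      rw [measure_iUnion₀ _ fun k => (hm k).nullMeasurableSet, hs _ n.succ_pos]
      intro k k' hne
      refine measure_mono_null ?_ (ae_iff.1 hρ)
      rintro x ⟨hx1, hx2⟩ hxG
      exact hne (Nat.add_left_cancel (between_unique hxG.2 hx1.1 hx2.1))
    filter_upwards [hρ, h1] with x hx hx1
    refine ⟨hx, fun t => ?_⟩
    obtain ⟨n, hn⟩ := exists_nat_gt t
    obtain ⟨k, hk⟩ := mem_iUnion.1 (hx1 n)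
    refine ⟨0 + k + 1, lt_trans ?_ hk.1.2⟩
    push_cast
    linarith
  have hGμ : ∀ᵐ x ∂μ, x ∈ G := hgood μ inferInstance hμ fun n hn => by
    rw [← hsum n hn]
    refine tsum_congr fun k => h _ fun p hp => ⟨n, by exact_mod_cast hn, ?_⟩
    simp only [List.mem_singleton] at hp
    simp [hp]
  have hGν := hgood ν inferInstance hν hsum
  refine ext_of_forall_iInter_le fun s q => ?_
  -- Good sequences are nonnegative, so a negative bound gives null sets on both sides.
  by_cases hq : ∃ k ∈ s, q k < 0
  · obtain ⟨k, hk, hqk⟩ := hq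
    have hz : ∀ ρ : Measure (ℕ → ℝ), (∀ᵐ x ∂ρ, x ∈ G) →
        ρ (⋂ k ∈ s, {x | x k ≤ q k}) = 0 := by
      intro ρ hρ
      refine measure_mono_null ?_ (ae_iff.1 hρ)
      intro x hx hxG
      have h1 : x k ≤ q k := mem_iInter₂.1 hx k hk
      have h2 := hxG.1.2.monotone (Nat.zero_le k)
      rw [hxG.1.1] at h2
      have : (q k : ℝ) < 0 := by exact_mod_cast hqk
      linarith
    rw [hz μ hGμ, hz ν hGν]
  · push Not at hq
    -- A common denominator: all bounds `q k` with `k ∈ s` lie on the grid of mesh `1 / D`.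
    let D : ℕ := ∏ k ∈ s, (q k).den
    have hD : 0 < D := Finset.prod_pos fun k _ => (q k).den_pos
    have hDr : (0 : ℝ) < D := by exact_mod_cast hD
    have hex : ∀ k ∈ s, ∃ c : ℕ, (q k : ℝ) = 0 + c * (1 / D : ℝ) := by
      intro k hk
      obtain ⟨e, he⟩ := Finset.dvd_prod_of_mem (fun k => (q k).den) hk
      have hnum : ((q k).num.toNat : ℤ) = (q k).num :=
        Int.toNat_of_nonneg (Rat.num_nonneg.2 (hq k hk))
      refine ⟨(q k).num.toNat * e, ?_⟩
      have hDe : (D : ℝ) = (q k).den * e := by exact_mod_cast he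
      have hden : ((q k).den : ℝ) ≠ 0 := by exact_mod_cast (q k).den_nz
      have he0 : (e : ℝ) ≠ 0 := by
        rintro h0
        rw [hDe, h0, mul_zero] at hDr
        exact lt_irrefl _ hDr
      have hnum' : ((q k).num.toNat : ℝ) = (q k).num := by exact_mod_cast hnum
      rw [hDe]
      push_cast
      rw [hnum', Rat.cast_def]
      field_simp
      ring
    choose! c hc using hex
    let M := s.sup c
    let E : Set (ℕ → ℝ) := ⋂ k ∈ s, {x | x k ≤ q k}
    let B : List ℕ → Set (ℕ → ℝ) := fun l => counts 0 0 (gridList (1 / D) l)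
    -- The count patterns realised by some good sequence in `E`. By `le_iff_le_of_mem_counts` every
    -- good sequence with such a pattern is in `E`, so `E` is, up to null sets, a countable disjoint
    -- union of count events.
    let K : Set (List ℕ) := {l | l.length = M ∧ ∃ y ∈ G, y ∈ B l ∧ y ∈ E}
    have hbase : ∀ x ∈ G, x 0 ≤ 0 ∧ 0 < x (0 + 1) := fun x hx =>
      ⟨hx.1.1.le, hx.1.1 ▸ hx.1.2 Nat.zero_lt_one⟩
    have hEB : ∀ x ∈ G, x ∈ E ↔ x ∈ ⋃ l ∈ K, B l := by
      intro x hx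
      constructor
      · intro hxE
        obtain ⟨l, hl, hxl⟩ := exists_mem_counts_gridList (h := 1 / D) hx.1.2 hx.2 (by positivity) M
          (hbase x hx).1
        exact mem_biUnion (show l ∈ K from ⟨hl, x, hx, hxl, hxE⟩) hxl
      · intro hxB
        obtain ⟨l, ⟨hl, y, hy, hyl, hyE⟩, hxl⟩ := mem_iUnion₂.1 hxB
        refine mem_iInter₂.2 fun k hk => ?_
        have hyk : y k ≤ q k := mem_iInter₂.1 hyE k hk
        simp only [mem_ofPred_eq]
        rw [hc k hk] at hyk ⊢
        exact (le_iff_le_of_mem_counts hx.1.2 hy.1.2 (hbase x hx) (hbase y hy) hxl hyl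
          (hl ▸ Finset.le_sup hk) k).2 hyk
    have hmeas : ∀ ρ : Measure (ℕ → ℝ), (∀ᵐ x ∂ρ, x ∈ G) → ρ E = ∑' l : K, ρ (B l) := by
      intro ρ hρ
      rw [← measure_biUnion₀ (Set.to_countable K) _
        fun l _ => (measurableSet_counts _ _ _).nullMeasurableSet]
      · refine measure_congr ?_
        filter_upwards [hρ] with x hx
        exact propext (hEB x hx)
      · intro l hl l' hl' hne
        refine measure_mono_null ?_ (ae_iff.1 hρ)
        rintro x ⟨hx1, hx2⟩ hxG
        exact hne (gridList_unique hxG.1.2 (hl.1.trans hl'.1.symm) hx1 hx2)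
    change μ E = ν E
    rw [hmeas μ hGμ, hmeas ν hGν]
    refine tsum_congr fun l => h _ fun p hp => ⟨1 / D, by positivity, ?_⟩
    obtain ⟨k, -, rfl⟩ := List.mem_map.1 hp
    simp

end MixedPoisson

/-! ### Arrival times of a counting process -/

namespace MixedPoisson

theorem arrival_nonneg {Ω : Type u} {N : ℝ≥0 → Ω → EReal} (n : ℕ) (ω : Ω) : 0 ≤ arrival N n ω :=
  NNReal.coe_nonneg _

variable {Ω : Type u} [MeasurableSpace Ω] {N : ℝ≥0 → Ω → EReal}

/-- Let τ be the infimum of the times at which the path is at least n. Right-continuity makes it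
attained. Before τ the values are integers below n, and a jump of size at most one cannot pass over
n, so the value at τ is exactly n. -/
theorem IsCountingProcess.exists_arrival (hN : IsCountingProcess N) (n : ℕ) (ω : Ω) :
    ∃ τ : ℝ≥0, N τ ω = (n : EReal) ∧ ∀ t, (n : EReal) ≤ N t ω ↔ τ ≤ t := by
  let S : Set ℝ≥0 := {t | (n : EReal) ≤ N t ω}
  have hne : S.Nonempty := by
    have h := (hN.tendsto_top ω).eventually (lt_mem_nhds (EReal.coe_lt_top (n : ℝ)))
    obtain ⟨t, ht⟩ := h.exists
    exact ⟨t, ht.le⟩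
  let τ := sInf S
  have hτ : (n : EReal) ≤ N τ ω := by
    by_contra! hlt
    have h1 : ∀ᶠ s in 𝓝[≥] τ, N s ω < n := (hN.right_continuous ω τ).eventually (gt_mem_nhds hlt)
    obtain ⟨u, hu, hsub⟩ := mem_nhdsGE_iff_exists_Ico_subset.1 h1
    obtain ⟨s, hs, hsu⟩ := (csInf_lt_iff (OrderBot.bddBelow S) hne).1 (mem_Ioi.1 hu)
    have : N s ω < n := hsub ⟨csInf_le (OrderBot.bddBelow S) hs, hsu⟩
    exact absurd hs (not_le.2 this)
  have hiff : ∀ t, (n : EReal) ≤ N t ω ↔ τ ≤ t := fun t =>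
    ⟨fun h => csInf_le (OrderBot.bddBelow S) h, fun h => hτ.trans (hN.monotone ω h)⟩
  refine ⟨τ, le_antisymm ?_ hτ, hiff⟩
  cases n with
  | zero =>
    have : τ = 0 := le_antisymm ((hiff 0).1 (by simp [hN.zero ω])) (zero_le)
    rw [this, hN.zero ω]
    simp
  | succ n =>
    have hpos : 0 < τ := by
      rw [← not_le]
      intro h0
      have := (hiff 0).2 h0
      rw [hN.zero ω] at this
      have h2 : ((n + 1 : ℕ) : EReal) ≤ ((0 : ℕ) : EReal) := by simpa using this
      simp at h2
      exact absurd h2 (by exact_mod_cast not_le.2 n.succ_pos)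
    refine (hN.jump_le_one ω τ hpos).trans ?_
    have hsup : (⨆ s : Iio τ, N s ω) ≤ (n : EReal) := by
      refine iSup_le fun s => ?_
      have hs : N s ω < ((n + 1 : ℕ) : EReal) := by
        rw [← not_le, hiff]
        exact not_le.2 s.2
      rcases hN.values s ω with ⟨k, hk⟩ | hk
      · rw [hk] at hs ⊢
        have : k < n + 1 := by exact_mod_cast hs
        exact_mod_cast Nat.lt_succ_iff.1 this
      · rw [hk] at hs
        exact absurd hs (not_lt.2 le_top)
    calc (⨆ s : Iio τ, N s ω) + 1 ≤ (n : EReal) + 1 := by gcongr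
      _ = ((n + 1 : ℕ) : EReal) := by push_cast; rfl

/-- The dictionary between counts and arrival times. As the level n is hit exactly, the infimum of
the times with value n is also that of the times with value at least n; it is taken over a nonempty
set, so the default value of `sInf ∅` plays no role. -/
theorem IsCountingProcess.arrival_le_iff (hN : IsCountingProcess N) (n : ℕ) (ω : Ω) (t : ℝ≥0) :
    arrival N n ω ≤ t ↔ (n : EReal) ≤ N t ω := by
  obtain ⟨τ, hτ, hiff⟩ := hN.exists_arrival n ω
  have : sInf {t : ℝ≥0 | N t ω = (n : EReal)} = τ :=
    le_antisymm (csInf_le (OrderBot.bddBelow _) hτ)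
      (le_csInf ⟨τ, hτ⟩ fun t ht => (hiff t).1 (le_of_eq (Eq.symm ht)))
  rw [arrival, this, hiff, NNReal.coe_le_coe]

theorem IsCountingProcess.apply_arrival (hN : IsCountingProcess N) (n : ℕ) (ω : Ω) :
    N ⟨arrival N n ω, arrival_nonneg n ω⟩ ω = (n : EReal) := by
  obtain ⟨τ, hτ, hiff⟩ := hN.exists_arrival n ω
  have h : (⟨arrival N n ω, arrival_nonneg n ω⟩ : ℝ≥0) = τ :=
    le_antisymm (NNReal.coe_le_coe.1 ((hN.arrival_le_iff n ω τ).2 hτ.ge))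
      ((hiff _).1 ((hN.arrival_le_iff n ω _).1 le_rfl))
  rw [h, hτ]

theorem IsCountingProcess.arrival_zero (hN : IsCountingProcess N) (ω : Ω) :
    arrival N 0 ω = 0 := by
  refine le_antisymm ?_ (arrival_nonneg _ _)
  have := (hN.arrival_le_iff 0 ω 0).2 (by simp [hN.zero ω])
  simpa using this

theorem IsCountingProcess.strictMono_arrival (hN : IsCountingProcess N) (ω : Ω) :
    StrictMono fun n => arrival N n ω := by
  refine strictMono_nat_of_lt_succ fun n => ?_
  by_contra! h
  have h1 := (hN.arrival_le_iff (n + 1) ω ⟨arrival N n ω, arrival_nonneg n ω⟩).1 h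
  rw [hN.apply_arrival] at h1
  have : n + 1 ≤ n := by exact_mod_cast h1
  omega

theorem IsCountingProcess.measurable_arrival (hN : IsCountingProcess N) (n : ℕ) :
    Measurable (arrival N n) := by
  refine measurable_of_Iic fun a => ?_
  by_cases ha : 0 ≤ a
  · have : arrival N n ⁻¹' Iic a = {ω | (n : EReal) ≤ N ⟨a, ha⟩ ω} := by
      ext ω
      exact hN.arrival_le_iff n ω ⟨a, ha⟩
    rw [this]
    exact measurableSet_le measurable_const (hN.measurable _)
  · have : arrival N n ⁻¹' Iic a = ∅ := by
      ext ω
      simp only [mem_preimage, mem_Iic, mem_empty_iff_false, iff_false, not_le]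
      exact (not_le.1 ha).trans_le (arrival_nonneg n ω)
    rw [this]
    exact MeasurableSet.empty

theorem IsCountingProcess.measurable_interarrival (hN : IsCountingProcess N) (n : ℕ) :
    Measurable (interarrival N n) :=
  (hN.measurable_arrival (n + 1)).sub (hN.measurable_arrival n)

theorem IsCountingProcess.interarrival_pos (hN : IsCountingProcess N) (n : ℕ) (ω : Ω) :
    0 < interarrival N n ω := sub_pos.2 (hN.strictMono_arrival ω n.lt_succ_self)

theorem IsCountingProcess.psum_interarrival (hN : IsCountingProcess N) (ω : Ω) :
    psum (fun n => interarrival N n ω) = fun n => arrival N n ω := by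
  funext n
  rw [psum]
  unfold interarrival
  rw [Finset.sum_range_sub (fun n => arrival N n ω), hN.arrival_zero, sub_zero]

theorem IsCountingProcess.eq_iff_arrival (hN : IsCountingProcess N) (n : ℕ) (ω : Ω) (t : ℝ≥0) :
    N t ω = (n : EReal) ↔ arrival N n ω ≤ t ∧ (t : ℝ) < arrival N (n + 1) ω := by
  rw [hN.arrival_le_iff, ← not_le, hN.arrival_le_iff]
  rcases hN.values t ω with ⟨k, hk⟩ | hk
  · rw [hk]
    have h1 : (k : EReal) = n ↔ k = n := by norm_cast
    have h2 : (n : EReal) ≤ k ↔ n ≤ k := by norm_cast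
    have h3 : ((n + 1 : ℕ) : EReal) ≤ k ↔ n + 1 ≤ k := by norm_cast
    rw [h1, h2, h3]
    omega
  · rw [hk]
    simpa using (EReal.coe_ne_top (n : ℝ)).symm

/-- Subtracting a finite count is harmless in `EReal`: the value `⊤` stays `⊤`, which is no natural
number. -/
theorem ereal_sub_natCast_eq_iff {a : EReal} (ha : (∃ k : ℕ, a = (k : EReal)) ∨ a = ⊤) (n k : ℕ) :
    a - (n : EReal) = (k : EReal) ↔ a = ((n + k : ℕ) : EReal) := by
  rcases ha with ⟨j, rfl⟩ | rfl
  · rw [show ((j : EReal) - (n : EReal)) = (((j : ℝ) - (n : ℝ) : ℝ) : EReal) from rfl,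
      show ((k : ℕ) : EReal) = ((k : ℝ) : EReal) from rfl, EReal.coe_eq_coe_iff]
    have : (j : EReal) = ((n + k : ℕ) : EReal) ↔ j = n + k := by norm_cast
    rw [this]
    constructor
    · intro h
      have h' : (j : ℝ) = ((n + k : ℕ) : ℝ) := by push_cast; linarith
      exact_mod_cast h'
    · rintro rfl
      push_cast; ring
  · rw [show (⊤ : EReal) - (n : EReal) = ⊤ from EReal.top_sub_coe n]
    constructor <;> intro h
    · exact absurd h.symm (EReal.coe_ne_top k)
    · exact absurd h.symm (EReal.coe_ne_top ((n + k : ℕ) : ℝ))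

/-- The gaps of a partition together with prescribed numbers of points. -/
def gapList {m : ℕ} (t : Fin (m + 1) → ℝ≥0) (κ : Fin m → ℕ) : List (ℝ × ℕ) :=
  List.ofFn fun j => ((t j.succ : ℝ) - t j.castSucc, κ j)

/-- The value `n` at the starting time is arbitrary because the induction restarts from the count
reached at the end of the first interval. -/
theorem IsCountingProcess.mem_counts_iff (hN : IsCountingProcess N) (ω : Ω) {m : ℕ}
    (t : Fin (m + 1) → ℝ≥0) (κ : Fin m → ℕ) (n : ℕ) (hn : N (t 0) ω = (n : EReal)) :
    (fun k => arrival N k ω) ∈ counts (t 0) n (gapList t κ) ↔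
      ∀ j, N (t j.succ) ω - N (t j.castSucc) ω = (κ j : EReal) := by
  induction m generalizing n with
  | zero => simp [gapList, counts]
  | succ m ih =>
    rw [gapList, List.ofFn_succ, Fin.forall_fin_succ]
    simp only [counts, mem_inter_iff, mem_ofPred_eq]
    have e1 : (t 0 : ℝ) + ((t (Fin.succ 0) : ℝ) - t (Fin.castSucc 0)) = t (Fin.succ 0) := by
      rw [Fin.castSucc_zero]; ring
    rw [e1, ← hN.eq_iff_arrival, Fin.castSucc_zero, hn,
      ereal_sub_natCast_eq_iff (hN.values _ ω)]
    refine and_congr_right fun h => ?_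
    exact ih (fun j => t j.succ) (fun j => κ j.succ) _ h

theorem IsCountingProcess.increments_event_eq (hN : IsCountingProcess N) {m : ℕ}
    (t : Fin (m + 1) → ℝ≥0) (ht : t 0 = 0) (κ : Fin m → ℕ) :
    (⋂ j : Fin m, {ω | N (t j.succ) ω - N (t j.castSucc) ω = (κ j : EReal)}) =
      {ω | (fun k => arrival N k ω) ∈ counts 0 0 (gapList t κ)} := by
  ext ω
  have := hN.mem_counts_iff ω t κ 0 (by rw [ht, hN.zero]; simp)
  rw [ht] at this
  simp only [mem_iInter, mem_ofPred_eq]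
  rw [← this]
  simp

theorem listWeight_gapList (θ : ℝ) {m : ℕ} (t : Fin (m + 1) → ℝ≥0) (κ : Fin m → ℕ) :
    listWeight θ (gapList t κ) =
      ∏ j : Fin m, poissonWeight θ ((t j.succ : ℝ) - t j.castSucc) (κ j) := by
  rw [listWeight, gapList, List.map_ofFn, List.prod_ofFn]
  rfl

/-- Every list of positive gaps comes from a partition. -/
theorem exists_partition_of_list (l : List (ℝ × ℕ)) (hl : ∀ p ∈ l, 0 < p.1) (s : ℝ≥0) :
    ∃ (t : Fin (l.length + 1) → ℝ≥0) (κ : Fin l.length → ℕ), t 0 = s ∧ StrictMono t ∧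
      gapList t κ = l := by
  induction l generalizing s with
  | nil => exact ⟨fun _ => s, fun _ => 0, rfl, Subsingleton.strictMono (α := Fin 1) _, rfl⟩
  | cons p l ih =>
    have hp : 0 < p.1 := hl p (by simp)
    obtain ⟨t, κ, h0, hmono, hgap⟩ := ih (fun q hq => hl q (by simp [hq])) (s + ⟨p.1, hp.le⟩)
    refine ⟨Fin.cons s t, Fin.cons p.2 κ, rfl, ?_, ?_⟩
    · refine Fin.strictMono_iff_lt_succ.2 fun j => ?_
      refine Fin.cases ?_ (fun j => ?_) j
      · simp only [Fin.castSucc_zero, Fin.cons_zero, Fin.cons_succ]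
        rw [h0]
        exact lt_add_of_pos_right s hp
      · rw [← Fin.succ_castSucc, Fin.cons_succ, Fin.cons_succ]
        exact hmono j.castSucc_lt_succ
    · rw [gapList, List.ofFn_succ]
      congr 1
      · refine Prod.ext ?_ rfl
        simp only [Fin.cons_succ, Fin.castSucc_zero, Fin.cons_zero, h0]
        exact add_sub_cancel_left (s : ℝ) p.1

end MixedPoisson

/-! ### Mixtures of exponential sequences and the law of the interarrival times -/

namespace MixedPoisson

/-- A probability measure on the line with exponential tails at the nonnegative rational numbers is
an exponential distribution. -/
theorem eq_expMeasure_of_Ioi {ν : Measure ℝ} [IsProbabilityMeasure ν] {θ : ℝ} (hθ : 0 < θ)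
    (h : ∀ q : ℚ, 0 ≤ q → ν (Ioi (q : ℝ)) = ENNReal.ofReal (Real.exp (-θ * q))) :
    ν = expMeasure θ := by
  have := isProbabilityMeasure_expMeasure hθ
  have h0 : ν (Ioi 0) = 1 := by simpa using h 0 le_rfl
  have h0' : expMeasure θ (Ioi 0) = 1 := by simpa using expMeasure_Ioi hθ le_rfl
  have hIoi : ∀ q : ℚ, ν (Ioi (q : ℝ)) = expMeasure θ (Ioi (q : ℝ)) := by
    intro q
    rcases le_total 0 q with hq | hq
    · rw [h q hq, expMeasure_Ioi hθ (by exact_mod_cast hq)]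
    · have hsub : Ioi (0 : ℝ) ⊆ Ioi (q : ℝ) := Ioi_subset_Ioi (by exact_mod_cast hq)
      rw [le_antisymm prob_le_one (h0 ▸ measure_mono hsub),
        le_antisymm prob_le_one (h0' ▸ measure_mono hsub)]
  refine ext_of_generate_finite _
    (BorelSpace.measurable_eq.trans Real.borel_eq_generateFrom_Iic_rat) Real.isPiSystem_Iic_rat
    ?_ (by simp)
  intro A hA
  obtain ⟨q, rfl⟩ : ∃ q : ℚ, A = Iic (q : ℝ) := by
    simpa only [mem_iUnion, mem_singleton_iff] using hA
  rw [← compl_Ioi, prob_compl_eq_one_sub measurableSet_Ioi, prob_compl_eq_one_sub measurableSet_Ioi,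
    hIoi]

/-- Scaling reduces every rate to rate one. Thus `mixLaw` can be an image of a product measure, and
for positive rates the measurability of the law in the rate comes from the product. -/
theorem map_div_expMeasure {θ : ℝ} (hθ : 0 < θ) :
    (expMeasure 1).map (fun x => x / θ) = expMeasure θ := by
  have := isProbabilityMeasure_expMeasure one_pos
  have hm : Measurable fun x : ℝ => x / θ := measurable_id.div_const θ
  have := Measure.isProbabilityMeasure_map (μ := expMeasure 1) hm.aemeasurable
  refine eq_expMeasure_of_Ioi hθ fun q hq => ?_
  have hq' : (0 : ℝ) ≤ q := by exact_mod_cast hq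
  have e : (fun x : ℝ => x / θ) ⁻¹' Ioi (q : ℝ) = Ioi (θ * q) := by
    ext x
    simp [lt_div_iff₀ hθ, mul_comm]
  rw [Measure.map_apply hm measurableSet_Ioi, e, expMeasure_Ioi one_pos (by positivity)]
  ring_nf

/-- The law of a sequence of random variables which are independent and exponential with parameter
`θ`, where `θ` is chosen with the distribution `U`. -/
noncomputable def mixLaw (U : Measure ℝ) : Measure (ℕ → ℝ) :=
  (U.prod (expSeq 1)).map fun p n => p.2 n / p.1

theorem measurable_div_seq (θ : ℝ) : Measurable fun (w : ℕ → ℝ) n => w n / θ := by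
  fun_prop

theorem map_div_expSeq {θ : ℝ} (hθ : 0 < θ) :
    (expSeq 1).map (fun w n => w n / θ) = expSeq θ := by
  have := isProbabilityMeasure_expMeasure one_pos
  rw [expSeq, Measure.infinitePi_map_pi (fun _ : ℕ => expMeasure 1) (f := fun _ x => x / θ)
    (fun _ => measurable_id.div_const θ), map_div_expMeasure hθ]
  rfl

theorem measurable_mixLaw_aux :
    Measurable fun (p : ℝ × (ℕ → ℝ)) (n : ℕ) => p.2 n / p.1 :=
  measurable_pi_lambda _ fun n => ((measurable_pi_apply n).comp measurable_snd).div measurable_fst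

theorem ae_pos_of_Ioi {U : Measure ℝ} [IsProbabilityMeasure U] (hU : U (Ioi 0) = 1) :
    ∀ᵐ θ ∂U, 0 < θ :=
  (mem_ae_iff_prob_eq_one measurableSet_Ioi).2 hU

theorem isProbabilityMeasure_mixLaw {U : Measure ℝ} [IsProbabilityMeasure U] :
    IsProbabilityMeasure (mixLaw U) := by
  have := isProbabilityMeasure_expSeq one_pos
  exact Measure.isProbabilityMeasure_map measurable_mixLaw_aux.aemeasurable

theorem mixLaw_apply {U : Measure ℝ} [IsProbabilityMeasure U] (hU : U (Ioi 0) = 1)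
    {A : Set (ℕ → ℝ)} (hA : MeasurableSet A) : mixLaw U A = ∫⁻ θ, expSeq θ A ∂U := by
  have := isProbabilityMeasure_expSeq one_pos
  rw [mixLaw, Measure.map_apply measurable_mixLaw_aux hA,
    Measure.prod_apply (measurable_mixLaw_aux hA)]
  refine lintegral_congr_ae ?_
  filter_upwards [ae_pos_of_Ioi hU] with θ hθ
  rw [← map_div_expSeq hθ, Measure.map_apply _ hA]
  · rfl
  · exact measurable_div_seq θ

/-- Makes the statements on mixtures apply to a single Poisson process. -/
theorem mixLaw_dirac {θ : ℝ} (hθ : 0 < θ) : mixLaw (Measure.dirac θ) = expSeq θ := by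
  have := isProbabilityMeasure_expSeq one_pos
  rw [mixLaw, Measure.dirac_prod, Measure.map_map measurable_mixLaw_aux measurable_prodMk_left,
    ← map_div_expSeq hθ]
  rfl

theorem measurableSet_psum_mem_counts (l : List (ℝ × ℕ)) :
    MeasurableSet {w | psum w ∈ counts 0 0 l} :=
  measurable_psum (measurableSet_counts l 0 0)

theorem mixLaw_counts {U : Measure ℝ} [IsProbabilityMeasure U] (hU : U (Ioi 0) = 1)
    (l : List (ℝ × ℕ)) (hl : ∀ p ∈ l, 0 ≤ p.1) :
    mixLaw U {w | psum w ∈ counts 0 0 l} = ∫⁻ θ, ENNReal.ofReal (listWeight θ l) ∂U := by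
  rw [mixLaw_apply hU (measurableSet_psum_mem_counts l)]
  refine lintegral_congr_ae ?_
  filter_upwards [ae_pos_of_Ioi hU] with θ hθ
  exact expSeq_counts hθ l hl

theorem ae_mixLaw_pos {U : Measure ℝ} [IsProbabilityMeasure U] (hU : U (Ioi 0) = 1) :
    ∀ᵐ w ∂(mixLaw U), ∀ n, 0 < w n := by
  have hm : MeasurableSet {w : ℕ → ℝ | ∀ n, 0 < w n} := by
    rw [ofPred_forall]
    exact MeasurableSet.iInter fun n => measurableSet_lt measurable_const (measurable_pi_apply n)
  rw [ae_iff]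
  change mixLaw U {w : ℕ → ℝ | ∀ n, 0 < w n}ᶜ = 0
  rw [mixLaw_apply hU hm.compl, lintegral_eq_zero_iff' ?_]
  · filter_upwards [ae_pos_of_Ioi hU] with θ hθ
    exact ae_iff.1 (ae_expSeq_pos hθ)
  · have := isProbabilityMeasure_expSeq one_pos
    refine ((measurable_measure_prodMk_left (ν := expSeq 1)
      (measurable_mixLaw_aux hm.compl)).aemeasurable).congr ?_
    filter_upwards [ae_pos_of_Ioi hU] with θ hθ
    rw [← map_div_expSeq hθ, Measure.map_apply _ hm.compl]
    · rfl
    · exact measurable_div_seq θ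

theorem poissonWeight_eq_poissonMeasure {θ d : ℝ} (hθ : 0 ≤ θ) (hd : 0 ≤ d) (k : ℕ) :
    ENNReal.ofReal (poissonWeight θ d k) = poissonMeasure (θ * d).toNNReal {k} := by
  rw [poissonMeasure_singleton, poissonWeight]
  have : ((θ * d).toNNReal : ℝ) = θ * d := Real.coe_toNNReal _ (mul_nonneg hθ hd)
  rw [this, neg_mul]

theorem tsum_poissonWeight {θ d : ℝ} (hθ : 0 ≤ θ) (hd : 0 ≤ d) :
    ∑' k, ENNReal.ofReal (poissonWeight θ d k) = 1 := by
  simp_rw [poissonWeight_eq_poissonMeasure hθ hd]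
  have := measure_iUnion (μ := poissonMeasure (θ * d).toNNReal) (f := fun k : ℕ => {k})
    (fun i j hij => by simpa using hij) (fun k => measurableSet_singleton k)
  rw [← this, iUnion_of_singleton, measure_univ]

/-- Almost surely only finitely many arrivals occur up to `t`; this supplies the summability
hypothesis of `ext_of_counts`. -/
theorem tsum_mixLaw_counts {U : Measure ℝ} [IsProbabilityMeasure U] (hU : U (Ioi 0) = 1) {t : ℝ}
    (ht : 0 ≤ t) : ∑' k, mixLaw U {w | psum w ∈ counts 0 0 [(t, k)]} = 1 := by
  have h : ∀ k, mixLaw U {w | psum w ∈ counts 0 0 [(t, k)]} =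
      ∫⁻ θ, ENNReal.ofReal (poissonWeight θ t k) ∂U := fun k => by
    rw [mixLaw_counts hU _ (by simpa using ht)]
    simp [listWeight]
  simp_rw [h]
  rw [← lintegral_tsum fun k => (measurable_poissonWeight_left t k).ennreal_ofReal.aemeasurable]
  rw [lintegral_congr_ae (g := fun _ => 1)]
  · simp
  · filter_upwards [ae_pos_of_Ioi hU] with θ hθ
    exact tsum_poissonWeight hθ.le ht

theorem psum_props {w : ℕ → ℝ} (hw : ∀ n, 0 < w n) : psum w 0 = 0 ∧ StrictMono (psum w) :=
  ⟨psum_zero w, strictMono_nat_of_lt_succ fun n => by rw [psum_succ]; linarith [hw n]⟩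

/-- The list of gaps with real entries which is given by a list with rational entries. -/
def ratList (l : List (ℚ × ℕ)) : List (ℝ × ℕ) := l.map fun p => ((p.1 : ℝ), p.2)

theorem ratList_pos {l : List (ℚ × ℕ)} (hl : ∀ p ∈ l, 0 < p.1) : ∀ p ∈ ratList l, 0 < p.1 := by
  intro p hp
  obtain ⟨q, hq, rfl⟩ := List.mem_map.1 hp
  exact Rat.cast_pos.2 (hl q hq)

variable {Ω : Type u} [MeasurableSpace Ω] {N : ℝ≥0 → Ω → EReal}

/-- The sequence of the interarrival times. -/
noncomputable def interSeq {Ω : Type u} (N : ℝ≥0 → Ω → EReal) (ω : Ω) : ℕ → ℝ :=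
  fun n => interarrival N n ω

theorem IsCountingProcess.measurable_interSeq (hN : IsCountingProcess N) :
    Measurable (interSeq N) :=
  measurable_pi_lambda _ hN.measurable_interarrival

theorem IsCountingProcess.map_interSeq_counts (hN : IsCountingProcess N) (Q : Measure Ω)
    (l : List (ℝ × ℕ)) :
    Q.map (interSeq N) {w | psum w ∈ counts 0 0 l} =
      Q {ω | (fun k => arrival N k ω) ∈ counts 0 0 l} := by
  rw [Measure.map_apply hN.measurable_interSeq (measurableSet_psum_mem_counts l)]
  refine congrArg Q ?_
  ext ω
  change psum (fun n => interarrival N n ω) ∈ counts 0 0 l ↔ _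
  rw [hN.psum_interarrival]
  rfl

/-- The law of the interarrival times is determined by the finite dimensional distributions of the
increments at rational times. -/
theorem IsCountingProcess.map_interSeq_eq_mixLaw (hN : IsCountingProcess N) (Q : Measure Ω)
    [IsProbabilityMeasure Q] {U : Measure ℝ} [IsProbabilityMeasure U] (hU : U (Ioi 0) = 1)
    (h : ∀ l : List (ℚ × ℕ), (∀ p ∈ l, 0 < p.1) →
      Q {ω | (fun k => arrival N k ω) ∈ counts 0 0 (ratList l)} =
        ∫⁻ θ, ENNReal.ofReal (listWeight θ (ratList l)) ∂U) :
    Q.map (interSeq N) = mixLaw U := by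
  have := Measure.isProbabilityMeasure_map (μ := Q) hN.measurable_interSeq.aemeasurable
  have := isProbabilityMeasure_mixLaw (U := U)
  have := Measure.isProbabilityMeasure_map (μ := Q.map (interSeq N)) measurable_psum.aemeasurable
  have := Measure.isProbabilityMeasure_map (μ := mixLaw U) measurable_psum.aemeasurable
  have hmc : ∀ l, MeasurableSet (counts 0 0 l) := fun l => measurableSet_counts l 0 0
  have hmS : MeasurableSet {x : ℕ → ℝ | x 0 = 0 ∧ StrictMono x} := by
    have e : {x : ℕ → ℝ | x 0 = 0 ∧ StrictMono x} = {x | x 0 = 0} ∩ ⋂ n, {x | x n < x (n + 1)} := by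
      ext x
      simp only [mem_inter_iff, mem_iInter, mem_ofPred_eq]
      exact and_congr_right fun _ => ⟨fun hx n => hx n.lt_succ_self, strictMono_nat_of_lt_succ⟩
    rw [e]
    exact (measurableSet_eq_fun (measurable_pi_apply 0) measurable_const).inter
      (MeasurableSet.iInter fun n =>
        measurableSet_lt (measurable_pi_apply n) (measurable_pi_apply (n + 1)))
  have key : (Q.map (interSeq N)).map psum = (mixLaw U).map psum := by
    refine ext_of_counts ?_ ?_ ?_ ?_
    · rw [ae_map_iff measurable_psum.aemeasurable hmS,
        ae_map_iff hN.measurable_interSeq.aemeasurable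
          (show MeasurableSet {w | psum w 0 = 0 ∧ StrictMono (psum w)} from measurable_psum hmS)]
      exact ae_of_all _ fun ω => psum_props fun n => hN.interarrival_pos n ω
    · rw [ae_map_iff measurable_psum.aemeasurable hmS]
      filter_upwards [ae_mixLaw_pos hU] with w hw using psum_props hw
    · intro n _
      simp_rw [Measure.map_apply measurable_psum (hmc _)]
      exact tsum_mixLaw_counts hU n.cast_nonneg
    · intro l hl
      have : ∃ l' : List (ℚ × ℕ), (∀ p ∈ l', 0 < p.1) ∧ ratList l' = l := by
        induction l with
        | nil => exact ⟨[], by simp, rfl⟩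
        | cons p l ih =>
          obtain ⟨q, hq, hpq⟩ := hl p (by simp)
          obtain ⟨l', hl', rfl⟩ := ih fun r hr => hl r (by simp [hr])
          refine ⟨(q, p.2) :: l', ?_, ?_⟩
          · rintro r hr
            rcases List.mem_cons.1 hr with rfl | hr
            · exact hq
            · exact hl' r hr
          · exact congrArg (· :: ratList l') (Prod.ext hpq.symm rfl)
      obtain ⟨l', hl', rfl⟩ := this
      rw [Measure.map_apply measurable_psum (hmc _), Measure.map_apply measurable_psum (hmc _)]
      change (Q.map (interSeq N)) {w | psum w ∈ counts 0 0 (ratList l')} =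
        mixLaw U {w | psum w ∈ counts 0 0 (ratList l')}
      rw [hN.map_interSeq_counts, h l' hl',
        mixLaw_counts hU _ fun p hp => (ratList_pos hl' p hp).le]
  -- Taking differences inverts `psum`, so equality of the laws of arrival times passes to
  -- interarrival times.
  let D : (ℕ → ℝ) → ℕ → ℝ := fun x n => x (n + 1) - x n
  have hD : Measurable D := measurable_pi_lambda _ fun n =>
    (measurable_pi_apply (n + 1)).sub (measurable_pi_apply n)
  have hDp : D ∘ psum = id := by
    funext w n
    simp only [D, Function.comp_apply, psum_succ, id]
    ring
  have := congrArg (Measure.map D) key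
  rwa [Measure.map_map hD measurable_psum, Measure.map_map hD measurable_psum, hDp, Measure.map_id,
    Measure.map_id] at this

/-- The finite dimensional distributions of a counting process with independent exponential
interarrival times with a random parameter. -/
theorem IsCountingProcess.increments_of_mixLaw (hN : IsCountingProcess N) {Q : Measure Ω}
    {U : Measure ℝ} [IsProbabilityMeasure U] (hU : U (Ioi 0) = 1)
    (h : Q.map (interSeq N) = mixLaw U) {m : ℕ} (t : Fin (m + 1) → ℝ≥0) (ht : IsPartition t)
    (κ : Fin m → ℕ) :
    Q (⋂ j : Fin m, {ω | N (t j.succ) ω - N (t j.castSucc) ω = (κ j : EReal)}) =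
      ∫⁻ θ, ENNReal.ofReal (∏ j : Fin m,
        poissonWeight θ ((t j.succ : ℝ) - t j.castSucc) (κ j)) ∂U := by
  rw [hN.increments_event_eq t ht.1, ← hN.map_interSeq_counts, h, mixLaw_counts hU]
  · simp_rw [listWeight_gapList]
  · intro p hp
    obtain ⟨j, rfl⟩ := List.mem_ofFn.1 hp
    exact sub_nonneg.2 (NNReal.coe_le_coe.2 (ht.2.monotone j.castSucc_lt_succ.le))

/-- The law of the interarrival times is determined by the finite dimensional distributions. -/
theorem IsCountingProcess.map_interSeq_of_increments (hN : IsCountingProcess N) (Q : Measure Ω)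
    [IsProbabilityMeasure Q] {U : Measure ℝ} [IsProbabilityMeasure U] (hU : U (Ioi 0) = 1)
    (h : ∀ (m : ℕ) (t : Fin (m + 1) → ℝ≥0), IsPartition t → ∀ κ : Fin m → ℕ,
      Q (⋂ j : Fin m, {ω | N (t j.succ) ω - N (t j.castSucc) ω = (κ j : EReal)}) =
        ∫⁻ θ, ENNReal.ofReal (∏ j : Fin m,
          poissonWeight θ ((t j.succ : ℝ) - t j.castSucc) (κ j)) ∂U) :
    Q.map (interSeq N) = mixLaw U := by
  refine hN.map_interSeq_eq_mixLaw Q hU fun l hl => ?_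
  obtain ⟨t, κ, h0, hmono, hgap⟩ := exists_partition_of_list (ratList l) (ratList_pos hl) 0
  rw [← hgap, ← hN.increments_event_eq t h0, h _ t ⟨h0, hmono⟩]
  simp_rw [listWeight_gapList]

end MixedPoisson

/-! ### Conditional probabilities, kernels and disintegrations -/

namespace MixedPoisson

variable {Ω : Type u} [MeasurableSpace Ω] {P : Measure Ω}
  {Y : Type v} [MeasurableSpace Y] {Θ : Ω → Y}

/-- A measurable function of `Θ` is a version of the conditional probability of an event given `Θ`
if and only if it satisfies the averaging identities. -/
theorem condProb_ae_eq_iff [IsProbabilityMeasure P]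
    (hΘ : Measurable Θ) {A : Set Ω} (hA : MeasurableSet A)
    {g : Y → ℝ≥0∞} (hg : Measurable g) (hfin : ∀ y, g y ≠ ∞) :
    P⟦A | sigmaOf Θ⟧ =ᵐ[P] (fun ω => (g (Θ ω)).toReal) ↔
      ∀ C : Set Y, MeasurableSet C → P (Θ ⁻¹' C ∩ A) = ∫⁻ y in C, g y ∂(P.map Θ) := by
  have hle : sigmaOf Θ ≤ (inferInstance : MeasurableSpace Ω) := hΘ.comap_le
  have hgΘ : Measurable fun ω => g (Θ ω) := hg.comp hΘ
  have hint : Integrable (A.indicator fun _ => (1 : ℝ)) P :=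
    (integrable_const _).indicator hA
  have hreal : ∀ C : Set Y, MeasurableSet C →
      ∫ ω in Θ ⁻¹' C, (g (Θ ω)).toReal ∂P = (∫⁻ y in C, g y ∂(P.map Θ)).toReal := by
    intro C hC
    rw [setLIntegral_map hC hg hΘ, integral_toReal hgΘ.aemeasurable
      (ae_of_all _ fun ω => (hfin _).lt_top)]
  have hind : ∀ C : Set Y, MeasurableSet C →
      ∫ ω in Θ ⁻¹' C, A.indicator (fun _ => (1 : ℝ)) ω ∂P = (P (Θ ⁻¹' C ∩ A)).toReal := by
    intro C hC
    rw [integral_indicator_const _ hA, measureReal_restrict_apply hA, smul_eq_mul, mul_one,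
      inter_comm, measureReal_def]
  constructor
  · intro h C hC
    have hi : Integrable (fun ω => (g (Θ ω)).toReal) P := integrable_condExp.congr h
    have hlt : ∫⁻ y in C, g y ∂(P.map Θ) ≠ ∞ := by
      rw [setLIntegral_map hC hg hΘ]
      refine ((setLIntegral_le_lintegral _ _).trans_lt ?_).ne
      have := hi.2
      rw [hasFiniteIntegral_iff_enorm] at this
      refine lt_of_le_of_lt (lintegral_mono fun ω => ?_) this
      rw [Real.enorm_eq_ofReal ENNReal.toReal_nonneg, ENNReal.ofReal_toReal (hfin _)]
    rw [← ENNReal.toReal_eq_toReal_iff' (measure_ne_top _ _) hlt, ← hreal C hC, ← hind C hC,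
      ← setIntegral_condExp hle hint ⟨C, hC, rfl⟩]
    exact integral_congr_ae (ae_restrict_of_ae h)
  · intro h
    have hi : Integrable (fun ω => (g (Θ ω)).toReal) P := by
      refine integrable_toReal_of_lintegral_ne_top hgΘ.aemeasurable ?_
      -- The identity for the whole space bounds the integral of `g` by the probability of `A`.
      rw [← lintegral_map hg hΘ, ← setLIntegral_univ, ← h univ MeasurableSet.univ]
      exact measure_ne_top _ _
    refine (ae_eq_condExp_of_forall_setIntegral_eq hle hint (fun _ _ _ => hi.integrableOn) ?_
      ?_).symm
    · rintro _ ⟨C, hC, rfl⟩ -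
      rw [hreal C hC, hind C hC, h C hC]
    · exact ((hg.comp (comap_measurable Θ)).ennreal_toReal).stronglyMeasurable.aestronglyMeasurable

/-- `κ` is a version of the conditional distribution of `Z` given `Θ`. -/
def Disintegrates {Ω' : Type*} [MeasurableSpace Ω'] (P : Measure Ω) (Θ : Ω → Y) (Z : Ω → Ω')
    (κ : Kernel Y Ω') : Prop :=
  ∀ (C : Set Y) (A : Set Ω'), MeasurableSet C → MeasurableSet A →
    P (Θ ⁻¹' C ∩ Z ⁻¹' A) = ∫⁻ y in C, κ y A ∂(P.map Θ)

theorem disintegrates_condDistrib [IsProbabilityMeasure P]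
    {Ω' : Type*} [MeasurableSpace Ω'] [StandardBorelSpace Ω']
    [Nonempty Ω'] (hΘ : Measurable Θ) {Z : Ω → Ω'} (hZ : Measurable Z) :
    Disintegrates P Θ Z (condDistrib Z Θ P) := by
  intro C A hC hA
  rw [← setLIntegral_preimage_condDistrib hΘ hZ.aemeasurable hA hC,
    setLIntegral_map hC (Kernel.measurable_coe _ hA) hΘ]

theorem Disintegrates.condProb_ae_eq [IsProbabilityMeasure P]
    {Ω' : Type*} [MeasurableSpace Ω'] {Z : Ω → Ω'}
    {κ : Kernel Y Ω'} [IsMarkovKernel κ] (h : Disintegrates P Θ Z κ) (hΘ : Measurable Θ)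
    (hZ : Measurable Z) {A : Set Ω'} (hA : MeasurableSet A) :
    P⟦Z ⁻¹' A | sigmaOf Θ⟧ =ᵐ[P] fun ω => (κ (Θ ω)).real A :=
  (condProb_ae_eq_iff hΘ (hZ hA) (Kernel.measurable_coe κ hA) fun _ => measure_ne_top _ _).2
    fun C hC => h C A hC hA

/-- Two versions of a conditional probability agree almost everywhere. -/
theorem Disintegrates.ae_eq [IsProbabilityMeasure P]
    {Ω' : Type*} [MeasurableSpace Ω'] {Z : Ω → Ω'} (hΘ : Measurable Θ)
    {κ : Kernel Y Ω'} (h : Disintegrates P Θ Z κ) {A : Set Ω'} (hA : MeasurableSet A)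
    {g : Y → ℝ≥0∞} (hg : Measurable g)
    (hPg : ∀ C : Set Y, MeasurableSet C → P (Θ ⁻¹' C ∩ Z ⁻¹' A) = ∫⁻ y in C, g y ∂(P.map Θ)) :
    ∀ᵐ y ∂(P.map Θ), κ y A = g y := by
  have := Measure.isProbabilityMeasure_map (μ := P) hΘ.aemeasurable
  refine ae_eq_of_forall_setLIntegral_eq_of_sigmaFinite (Kernel.measurable_coe κ hA) hg ?_
  intro C hC _
  rw [← h C A hC hA, hPg C hC]

/-- Conditional independence carries over to the conditional distribution. -/
theorem Disintegrates.ae_iInter_le [IsProbabilityMeasure P]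
    {Ω' : Type*} [MeasurableSpace Ω'] {Z : Ω → Ω'}
    {κ : Kernel Y Ω'} [IsMarkovKernel κ] (h : Disintegrates P Θ Z κ) (hΘ : Measurable Θ)
    (hZ : Measurable Z) {ι E : Type*} [TopologicalSpace E] [LinearOrder E] [OrderClosedTopology E]
    [SecondCountableTopology E] [MeasurableSpace E] [BorelSpace E]
    {X : ι → Ω' → E} (hX : ∀ i, Measurable (X i))
    (hci : CondIndepFamily P Θ fun i ω => X i (Z ω)) (s : Finset ι) (x : ι → E) :
    ∀ᵐ y ∂(P.map Θ), κ y (⋂ i ∈ s, {z | X i z ≤ x i}) = ∏ i ∈ s, κ y {z | X i z ≤ x i} := by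
  have hm : ∀ i, MeasurableSet {z | X i z ≤ x i} := fun i =>
    measurableSet_le (hX i) measurable_const
  have hmI : MeasurableSet (⋂ i ∈ s, {z | X i z ≤ x i}) :=
    Finset.measurableSet_biInter _ fun i _ => hm i
  have hmeas : MeasurableSet {y | κ y (⋂ i ∈ s, {z | X i z ≤ x i}) =
      ∏ i ∈ s, κ y {z | X i z ≤ x i}} :=
    measurableSet_eq_fun (Kernel.measurable_coe κ hmI)
      (Finset.measurable_prod _ fun i _ => Kernel.measurable_coe κ (hm i))
  rw [ae_map_iff hΘ.aemeasurable hmeas]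
  have h1 := h.condProb_ae_eq hΘ hZ hmI
  have h2 : ∀ᵐ ω ∂P, ∀ i ∈ s, (P⟦{ω | X i (Z ω) ≤ x i} | sigmaOf Θ⟧) ω =
      (κ (Θ ω)).real {z | X i z ≤ x i} :=
    (ae_ball_iff s.countable_toSet).2 fun i _ => h.condProb_ae_eq hΘ hZ (hm i)
  have e : Z ⁻¹' (⋂ i ∈ s, {z | X i z ≤ x i}) = ⋂ i ∈ s, {ω | X i (Z ω) ≤ x i} := by
    ext ω; simp
  rw [e] at h1
  filter_upwards [h1, h2, hci s x] with ω h1 h2 h3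
  rw [h3, Finset.prod_congr rfl h2] at h1
  rw [← ENNReal.toReal_eq_toReal_iff' (measure_ne_top _ _)
    (ENNReal.prod_ne_top fun i _ => measure_ne_top _ _), ENNReal.toReal_prod]
  exact h1.symm

/-- Half-lines form a generating π-system, and on them the product formula is
`Disintegrates.ae_iInter_le`. Independence with respect to a kernel lets the null set depend on the
events, so uncountably many thresholds cause no difficulty. -/
theorem Disintegrates.iIndepFun [IsProbabilityMeasure P]
    {Ω' : Type*} [MeasurableSpace Ω'] {Z : Ω → Ω'}
    {κ : Kernel Y Ω'} [IsMarkovKernel κ] (h : Disintegrates P Θ Z κ) (hΘ : Measurable Θ)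
    (hZ : Measurable Z) {ι E : Type*} [TopologicalSpace E] [LinearOrder E] [OrderTopology E]
    [SecondCountableTopology E] [MeasurableSpace E] [BorelSpace E]
    {X : ι → Ω' → E} (hX : ∀ i, Measurable (X i))
    (hci : CondIndepFamily P Θ fun i ω => X i (Z ω)) : Kernel.iIndepFun X κ (P.map Θ) := by
  refine Kernel.iIndepSets.iIndep _ (fun i => (hX i).comap_le)
    (fun i => preimage (X i) '' range Iic) ?_ ?_ ?_
  · rintro i _ ⟨_, ⟨a, rfl⟩, rfl⟩ _ ⟨_, ⟨b, rfl⟩, rfl⟩ -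
    exact ⟨Iic (min a b), ⟨_, rfl⟩, by rw [← Iic_inter_Iic, preimage_inter]⟩
  · intro i
    rw [BorelSpace.measurable_eq (α := E), borel_eq_generateFrom_Iic,
      MeasurableSpace.comap_generateFrom]
  · intro s f hf
    have : ∀ i ∈ s, ∃ a, f i = {z | X i z ≤ a} := by
      intro i hi
      obtain ⟨_, ⟨a, rfl⟩, h⟩ := hf i hi
      exact ⟨a, h.symm⟩
    -- If `E` is empty no threshold exists, which forces the finite index set to be empty.
    by_cases hne : Nonempty E
    · choose! x hx using this
      filter_upwards [h.ae_iInter_le hΘ hZ hX hci s x] with y hy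
      rw [iInter₂_congr hx, hy]
      exact Finset.prod_congr rfl fun i hi => by rw [hx i hi]
    · have hs : s = ∅ := by
        by_contra hs
        obtain ⟨i, hi⟩ := Finset.nonempty_iff_ne_empty.2 hs
        obtain ⟨a, -⟩ := this i hi
        exact hne ⟨a⟩
      subst hs
      simp

/-- A disintegration as a kernel. -/
noncomputable def IsDisintegration.kernel {Q : Y → Measure Ω} {μ : Measure Y}
    (hQ : IsDisintegration Q P μ) : Kernel Y Ω :=
  ⟨Q, Measure.measurable_of_measurable_coe _ hQ.measurable⟩

theorem IsDisintegration.isMarkovKernel {Q : Y → Measure Ω} {μ : Measure Y}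
    (hQ : IsDisintegration Q P μ) : IsMarkovKernel hQ.kernel :=
  ⟨hQ.prob⟩

/-- By consistency `Q y` gives the event `Θ ⁻¹' C` mass one for almost all `y ∈ C` and, applied to
the complement, mass zero for almost all `y ∉ C`. Intersecting with this event thus acts as the
indicator of `C`. -/
theorem IsDisintegration.disintegrates {Q : Y → Measure Ω} (hΘ : Measurable Θ)
    (hQ : IsDisintegration Q P (P.map Θ)) (hc : IsConsistent Q (P.map Θ) Θ) :
    Disintegrates P Θ id hQ.kernel := by
  intro C A hC hA
  rw [preimage_id, ← hQ.lintegral_eq _ ((hΘ hC).inter hA), ← lintegral_indicator hC]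
  refine lintegral_congr_ae ?_
  filter_upwards [hc C hC, hc Cᶜ hC.compl] with y h1 h2
  have := hQ.prob y
  change Q y (Θ ⁻¹' C ∩ A) = C.indicator (fun y => Q y A) y
  by_cases hy : y ∈ C
  · rw [indicator_of_mem hy]
    have : Q y (Θ ⁻¹' C)ᶜ = 0 := (prob_compl_eq_zero_iff (hΘ hC)).2 (h1 hy)
    rw [inter_comm, measure_inter_conull this]
  · rw [indicator_of_notMem hy]
    have : Q y (Θ ⁻¹' C) = 0 := by
      have := h2 hy
      rwa [preimage_compl, prob_compl_eq_one_iff (hΘ hC)] at this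
    exact measure_mono_null inter_subset_left this

theorem Disintegrates.isDisintegration {κ : Kernel Y Ω} [IsMarkovKernel κ]
    (h : Disintegrates P Θ id κ) : IsDisintegration (fun y => κ y) P (P.map Θ) where
  prob y := inferInstance
  measurable E hE := Kernel.measurable_coe κ hE
  lintegral_eq E hE := by
    have := h univ E MeasurableSet.univ hE
    simpa using this.symm

/-- The mass of `Θ ⁻¹' B` under `κ y` and the indicator of `B` at `y` have the same integral over
every measurable set, hence agree almost everywhere. -/
theorem Disintegrates.isConsistent [IsProbabilityMeasure P]
    {κ : Kernel Y Ω} [IsMarkovKernel κ] (hΘ : Measurable Θ)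
    (h : Disintegrates P Θ id κ) : IsConsistent (fun y => κ y) (P.map Θ) Θ := by
  intro B hB
  have h1 := Disintegrates.ae_eq hΘ h (hΘ hB) (g := B.indicator 1)
    (measurable_one.indicator hB) ?_
  · filter_upwards [h1] with y hy hyB
    rw [hy, indicator_of_mem hyB, Pi.one_apply]
  · intro C hC
    rw [preimage_id, ← preimage_inter, lintegral_indicator_one hB, Measure.restrict_apply hB,
      inter_comm, Measure.map_apply hΘ (hB.inter hC)]

/-- If `P` is perfect and the σ-algebra is countably generated, there are conditional probabilities
given `Θ`. -/
theorem IsPerfect.exists_disintegrates [IsProbabilityMeasure P] (hP : IsPerfect P)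
    (hcg : MeasurableSpace.CountablyGenerated Ω) (hΘ : Measurable Θ) :
    ∃ κ : Kernel Y Ω, IsMarkovKernel κ ∧ Disintegrates P Θ id κ := by
  have hne : Nonempty Ω := nonempty_of_isProbabilityMeasure P
  obtain ⟨e, he⟩ := exists_measurableEmbedding_real (ℕ → Bool)
  -- The memberships of `ω` in a generating sequence of events, coded as one real number; `g`
  -- generates the whole σ-algebra.
  let g : Ω → ℝ := fun ω => e (MeasurableSpace.mapNatBool Ω ω)
  have hg : Measurable g := he.measurable.comp (MeasurableSpace.measurable_mapNatBool Ω)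
  have hgen : ∀ A : Set Ω, MeasurableSet A → ∃ A' : Set ℝ, MeasurableSet A' ∧ g ⁻¹' A' = A := by
    have hle : (inferInstance : MeasurableSpace Ω) ≤ MeasurableSpace.comap g inferInstance := by
      conv_lhs => rw [← MeasurableSpace.generateFrom_natGeneratingSequence Ω]
      refine MeasurableSpace.generateFrom_le ?_
      rintro _ ⟨n, rfl⟩
      refine ⟨e '' {b | b n = true}, he.measurableSet_image.2 ?_, ?_⟩
      · exact measurableSet_eq_fun (measurable_pi_apply n) measurable_const
      · ext ω
        simp only [g, mem_preimage, he.injective.mem_set_image, MeasurableSpace.mapNatBool,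
          mem_ofPred_eq, decide_eq_true_eq]
    exact fun A hA => hle A hA
  obtain ⟨B, hB, hBr, hPB⟩ := hP g hg
  classical
  have hBr' : ∀ x ∈ B, ∃ ω, g ω = x := fun x hx => hBr hx
  choose! r hr using hBr'
  -- A section of `g` over the Borel set `B` that perfectness provides, constant off `B`. It carries
  -- the conditional law of `g`, which exists on the real line, back to `Ω`.
  let s : ℝ → Ω := fun x => if x ∈ B then r x else Classical.choice hne
  have hs : Measurable s := by
    intro A hA
    obtain ⟨A', hA', rfl⟩ := hgen A hA
    have e1 : s ⁻¹' (g ⁻¹' A') = (B ∩ A') ∪ (Bᶜ ∩ {_x | g (Classical.choice hne) ∈ A'}) := by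
      ext x
      by_cases hx : x ∈ B
      · simp [s, hx, hr x hx]
      · simp [s, hx]
    rw [e1]
    exact (hB.inter hA').union (hB.compl.inter (MeasurableSet.const _))
  have hκ := disintegrates_condDistrib (P := P) hΘ hg
  refine ⟨(condDistrib g Θ P).map s, Kernel.IsMarkovKernel.map _ hs, fun C A hC hA => ?_⟩
  simp_rw [Kernel.map_apply' _ hs _ hA]
  rw [← hκ C _ hC (hs hA), preimage_id]
  refine measure_congr ?_
  have hae : ∀ᵐ ω ∂P, g ω ∈ B := (mem_ae_iff_prob_eq_one (hg hB)).2 hPB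
  filter_upwards [hae] with ω hω
  obtain ⟨A', hA', rfl⟩ := hgen A hA
  -- The point `s (g ω)` may differ from `ω`, but every event has the form `g ⁻¹' A'`, so no event
  -- separates the two.
  have : g (s (g ω)) = g ω := by simp only [s, if_pos hω, hr _ hω]
  refine propext ?_
  change ω ∈ Θ ⁻¹' C ∩ g ⁻¹' A' ↔ ω ∈ Θ ⁻¹' C ∩ g ⁻¹' (s ⁻¹' (g ⁻¹' A'))
  simp only [mem_inter_iff, mem_preimage, this]

end MixedPoisson

/-! ### Poisson processes and conditionally Poisson increments -/

namespace MixedPoisson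

variable {Ω : Type u} [MeasurableSpace Ω] {N : ℝ≥0 → Ω → EReal}

theorem isProbabilityMeasure_poissonLaw (r : ℝ) : IsProbabilityMeasure (poissonLaw r) :=
  Measure.isProbabilityMeasure_map (measurable_from_top).aemeasurable

theorem natCast_ereal_injective : Function.Injective fun k : ℕ => (k : EReal) := fun a b h => by
  exact_mod_cast (show (a : EReal) = b from h)

theorem poissonLaw_singleton {θ d : ℝ} (hθ : 0 ≤ θ) (hd : 0 ≤ d) (k : ℕ) :
    poissonLaw (θ * d) {(k : EReal)} = ENNReal.ofReal (poissonWeight θ d k) := by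
  rw [poissonLaw, Measure.map_apply measurable_from_top (measurableSet_singleton _),
    poissonWeight_eq_poissonMeasure hθ hd]
  congr 1
  ext j
  exact natCast_ereal_injective.eq_iff

/-- A probability measure on vectors of extended real numbers is a product of Poisson laws if it has
the right values at the vectors of natural numbers. -/
theorem eq_pi_poissonLaw {m : ℕ} {ρ : Measure (Fin m → EReal)} [IsProbabilityMeasure ρ] {θ : ℝ}
    (hθ : 0 ≤ θ) {d : Fin m → ℝ} (hd : ∀ j, 0 ≤ d j)
    (h : ∀ κ : Fin m → ℕ,
      ρ {fun j => (κ j : EReal)} = ENNReal.ofReal (∏ j, poissonWeight θ (d j) (κ j))) :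
    ρ = Measure.pi fun j => poissonLaw (θ * d j) := by
  let c : (Fin m → ℕ) → Fin m → EReal := fun κ j => (κ j : EReal)
  have hinj : Function.Injective c := fun a b hab =>
    funext fun j => natCast_ereal_injective (congrFun hab j)
  have hc : MeasurableEmbedding c :=
    ⟨hinj, measurable_pi_lambda _ fun j => measurable_from_top.comp (measurable_pi_apply j),
      fun s _ => (s.to_countable.image c).measurableSet⟩
  have hprob := fun j => isProbabilityMeasure_poissonLaw (θ * d j)
  let π : Measure (Fin m → ℕ) := Measure.pi fun j => poissonMeasure (θ * d j).toNNReal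
  have hπ : π.map c = Measure.pi fun j => poissonLaw (θ * d j) :=
    Measure.pi_map_pi (μ := fun j => poissonMeasure (θ * d j).toNNReal)
      (f := fun _ (k : ℕ) => (k : EReal)) (hμ := fun j => by
        have : IsProbabilityMeasure (Measure.map (fun k : ℕ => (k : EReal))
          (poissonMeasure (θ * d j).toNNReal)) := hprob j
        infer_instance) fun j => measurable_from_top.aemeasurable
  have hcomap : ρ.comap c = π := by
    refine Measure.ext_of_singleton fun κ => ?_
    rw [hc.comap_apply, image_singleton]
    change ρ {fun j => (κ j : EReal)} = _
    rw [h κ, Measure.pi_singleton, ENNReal.ofReal_prod_of_nonneg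
      fun j _ => poissonWeight_nonneg hθ (hd j) _]
    exact Finset.prod_congr rfl fun j _ => poissonWeight_eq_poissonMeasure hθ (hd j) _
  -- The vectors of natural numbers already carry mass one, so `ρ` has no mass elsewhere, in
  -- particular none at infinite values.
  rw [← hπ, ← hcomap, hc.map_comap, Measure.restrict_eq_self_of_ae_mem]
  refine (mem_ae_iff_prob_eq_one hc.measurableSet_range).2 ?_
  rw [← image_univ, ← hc.comap_apply, hcomap, measure_univ]

theorem IsCountingProcess.measurable_sub (hN : IsCountingProcess N) (s t : ℝ≥0) :
    Measurable fun ω => N t ω - N s ω := by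
  simp_rw [sub_eq_add_neg]
  exact (hN.measurable t).add (continuous_neg.measurable.comp (hN.measurable s))

theorem IsCountingProcess.measurable_increments (hN : IsCountingProcess N) {m : ℕ}
    (t : Fin (m + 1) → ℝ≥0) (h : ℝ≥0) : Measurable (increments N t h) :=
  measurable_pi_lambda _ fun _ => hN.measurable_sub _ _

theorem increments_zero_eq {Ω : Type u} (N : ℝ≥0 → Ω → EReal) {m : ℕ} (t : Fin (m + 1) → ℝ≥0)
    (ω : Ω) (j : Fin m) : increments N t 0 ω j = N (t j.succ) ω - N (t j.castSucc) ω := by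
  simp [increments]

/-- The partition `0 < t`. -/
def pairPartition (t : ℝ≥0) : Fin 2 → ℝ≥0 := ![0, t]

theorem isPartition_pairPartition {t : ℝ≥0} (ht : 0 < t) : IsPartition (pairPartition t) := by
  refine ⟨rfl, Fin.strictMono_iff_lt_succ.2 fun j => ?_⟩
  fin_cases j
  exact ht

theorem increments_pairPartition {Ω : Type u} (N : ℝ≥0 → Ω → EReal) (t h : ℝ≥0) (ω : Ω)
    (j : Fin 1) : increments N (pairPartition t) h ω j = N (t + h) ω - N h ω := by
  fin_cases j
  simp [increments, pairPartition]

theorem IsPartition.sub_nonneg {m : ℕ} {t : Fin (m + 1) → ℝ≥0} (ht : IsPartition t) (j : Fin m) :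
    0 ≤ (t j.succ : ℝ) - t j.castSucc :=
  _root_.sub_nonneg.2 (NNReal.coe_le_coe.2 (ht.2.monotone j.castSucc_lt_succ.le))

theorem IsPartition.sub_pos {m : ℕ} {t : Fin (m + 1) → ℝ≥0} (ht : IsPartition t) (j : Fin m) :
    t j.castSucc < t j.succ := ht.2 j.castSucc_lt_succ

theorem IsCountingProcess.increments_of_expSeq (hN : IsCountingProcess N) {Q : Measure Ω} {θ : ℝ}
    (hθ : 0 < θ) (h : Q.map (interSeq N) = expSeq θ) {m : ℕ} (t : Fin (m + 1) → ℝ≥0)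
    (ht : IsPartition t) (κ : Fin m → ℕ) :
    Q (⋂ j : Fin m, {ω | N (t j.succ) ω - N (t j.castSucc) ω = (κ j : EReal)}) =
      ENNReal.ofReal (∏ j : Fin m, poissonWeight θ ((t j.succ : ℝ) - t j.castSucc) (κ j)) := by
  rw [hN.increments_of_mixLaw (U := Measure.dirac θ) (by simp [hθ])
    (h.trans (mixLaw_dirac hθ).symm) t ht κ, lintegral_dirac]

theorem IsCountingProcess.map_increments_zero (hN : IsCountingProcess N) {Q : Measure Ω}
    [IsProbabilityMeasure Q] {θ : ℝ} (hθ : 0 < θ) (h : Q.map (interSeq N) = expSeq θ) {m : ℕ}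
    {t : Fin (m + 1) → ℝ≥0} (ht : IsPartition t) :
    Q.map (increments N t 0) =
      Measure.pi fun j => poissonLaw (θ * ((t j.succ : ℝ) - t j.castSucc)) := by
  have := Measure.isProbabilityMeasure_map (μ := Q) (hN.measurable_increments t 0).aemeasurable
  refine eq_pi_poissonLaw hθ.le ht.sub_nonneg fun κ => ?_
  rw [Measure.map_apply (hN.measurable_increments t 0) (measurableSet_singleton _),
    ← hN.increments_of_expSeq hθ h t ht κ]
  congr 1
  ext ω
  simp only [mem_preimage, mem_singleton_iff, mem_iInter, mem_ofPred_eq, funext_iff,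
    increments_zero_eq]

theorem IsCountingProcess.iIndepFun_increments (hN : IsCountingProcess N) {Q : Measure Ω}
    [IsProbabilityMeasure Q] {θ : ℝ} (hθ : 0 < θ) (h : Q.map (interSeq N) = expSeq θ) {m : ℕ}
    {t : Fin (m + 1) → ℝ≥0} (ht : IsPartition t) :
    (∀ j, Q.map (fun ω => increments N t 0 ω j) =
      poissonLaw (θ * ((t j.succ : ℝ) - t j.castSucc))) ∧
    iIndepFun (fun j ω => increments N t 0 ω j) Q := by
  have hX := hN.measurable_increments t 0
  have hprob := fun j : Fin m =>
    isProbabilityMeasure_poissonLaw (θ * ((t j.succ : ℝ) - t j.castSucc))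
  have hmap := hN.map_increments_zero hθ h ht
  have hmarg : ∀ j, Q.map (fun ω => increments N t 0 ω j) =
      poissonLaw (θ * ((t j.succ : ℝ) - t j.castSucc)) := by
    intro j
    have h1 := (measurePreserving_eval
      (fun j : Fin m => poissonLaw (θ * ((t j.succ : ℝ) - t j.castSucc))) j).map_eq
    rw [← hmap, Measure.map_map (measurable_pi_apply j) hX] at h1
    exact h1
  refine ⟨hmarg, ?_⟩
  have hm : ∀ j, Measurable fun ω => increments N t 0 ω j := fun j =>
    (measurable_pi_apply j).comp hX
  rw [iIndepFun_iff_map_fun_eq_pi_map fun j => (hm j).aemeasurable]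
  simp_rw [hmarg]
  exact hmap

theorem IsCountingProcess.map_increments (hN : IsCountingProcess N) {Q : Measure Ω}
    [IsProbabilityMeasure Q] {θ : ℝ} (hθ : 0 < θ) (h : Q.map (interSeq N) = expSeq θ) {m : ℕ}
    {t : Fin (m + 1) → ℝ≥0} (ht : IsPartition t) {s : ℝ≥0} (hs : 0 < s) :
    Q.map (increments N t s) =
      Measure.pi fun j => poissonLaw (θ * ((t j.succ : ℝ) - t j.castSucc)) := by
  -- Put 0 in front of the shifted times; as `s` is positive this is a partition. Its increments
  -- after the first are the shifted ones, and their laws depend only on the gap lengths.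
  let t' : Fin (m + 2) → ℝ≥0 := Fin.cons 0 fun j => t j + s
  have ht' : IsPartition t' := by
    refine ⟨rfl, Fin.strictMono_iff_lt_succ.2 fun j => ?_⟩
    refine Fin.cases ?_ (fun j => ?_) j
    · simp only [t', Fin.castSucc_zero, Fin.cons_zero, Fin.cons_succ]
      exact lt_of_lt_of_le hs le_add_self
    · simp only [t', ← Fin.succ_castSucc, Fin.cons_succ]
      exact add_lt_add_of_lt_of_le (ht.sub_pos j) le_rfl
  obtain ⟨hmarg, hind⟩ := hN.iIndepFun_increments hθ h ht'
  have e : ∀ (j : Fin m) (ω : Ω), increments N t' 0 ω j.succ = increments N t s ω j := by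
    intro j ω
    rw [increments_zero_eq]
    simp only [t', ← Fin.succ_castSucc, Fin.cons_succ, increments]
  have h1 := hind.precomp (Fin.succ_injective m)
  simp only [e] at h1
  have hm : ∀ j, Measurable fun ω => increments N t s ω j := fun j =>
    (measurable_pi_apply j).comp (hN.measurable_increments t s)
  rw [iIndepFun_iff_map_fun_eq_pi_map fun j => (hm j).aemeasurable] at h1
  refine Eq.trans h1 ?_
  congr 1
  funext j
  have h2 := hmarg j.succ
  simp only [e] at h2
  rw [h2]
  simp only [t', ← Fin.succ_castSucc, Fin.cons_succ, NNReal.coe_add, add_sub_add_right_eq_sub]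

/-- A counting process with independent exponential interarrival times is a Poisson process. -/
theorem IsCountingProcess.isPoissonProcess (hN : IsCountingProcess N) {Q : Measure Ω}
    [IsProbabilityMeasure Q] {θ : ℝ} (hθ : 0 < θ) (h : Q.map (interSeq N) = expSeq θ) :
    IsPoissonProcess Q N θ where
  pos := hθ
  indep m t ht := (hN.iIndepFun_increments hθ h ht).2
  stationary m t ht s hs := by
    rw [hN.map_increments hθ h ht hs, hN.map_increments_zero hθ h ht]
  law t ht := by
    have h1 := (hN.iIndepFun_increments hθ h (isPartition_pairPartition ht)).1 0
    simp only [increments_pairPartition, add_zero, hN.zero, sub_zero] at h1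
    rw [h1]
    simp [pairPartition]

theorem IsCountingProcess.iIndepFun_interarrival (hN : IsCountingProcess N) {Q : Measure Ω}
    [IsProbabilityMeasure Q] {θ : ℝ} (hθ : 0 < θ) (h : Q.map (interSeq N) = expSeq θ) :
    iIndepFun (interarrival N) Q ∧ ∀ n, Q.map (interarrival N n) = expMeasure θ := by
  have := isProbabilityMeasure_expMeasure hθ
  have hmarg : ∀ n, Q.map (interarrival N n) = expMeasure θ := by
    intro n
    have h1 := Measure.infinitePi_map_eval (fun _ : ℕ => expMeasure θ) n
    change (expSeq θ).map _ = _ at h1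
    rwa [← h, Measure.map_map (measurable_pi_apply n) hN.measurable_interSeq] at h1
  refine ⟨?_, hmarg⟩
  rw [iIndepFun_iff_map_fun_eq_infinitePi_map hN.measurable_interarrival]
  simp_rw [hmarg]
  exact h

variable {P : Measure Ω}

/-- The conditional distributions of the increments of `N` given `Θ` are those of a Poisson process
with parameter `Θ`. -/
structure HasPoissonIncrements (P : Measure Ω) (N : ℝ≥0 → Ω → EReal) (Θ : Ω → ℝ) : Prop where
  measurable : Measurable Θ
  pos : P.map Θ (Ioi 0) = 1
  measure_inter : ∀ (m : ℕ) (t : Fin (m + 1) → ℝ≥0), IsPartition t → ∀ (κ : Fin m → ℕ) (C : Set ℝ),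
    MeasurableSet C →
    P (Θ ⁻¹' C ∩ ⋂ j : Fin m, {ω | N (t j.succ) ω - N (t j.castSucc) ω = (κ j : EReal)}) =
      ∫⁻ θ in C, ENNReal.ofReal (∏ j : Fin m,
        poissonWeight θ ((t j.succ : ℝ) - t j.castSucc) (κ j)) ∂(P.map Θ)

/-- The vector of increments takes values in a standard Borel space, so it has a conditional
distribution given `Θ` without any assumption on `Ω`. Conditional independence makes its point
masses products; conditional stationarity and N_0 = 0 replace each increment by the process at time
equal to the gap, whose conditional law is Poisson. -/
theorem IsMPPParameter.hasPoissonIncrements [IsProbabilityMeasure P] (hN : IsCountingProcess N)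
    {Θ : Ω → ℝ} (h : IsMPPParameter P N Θ) : HasPoissonIncrements P N Θ where
  measurable := h.measurable
  pos := h.pos
  measure_inter m t ht κ C hC := by
    have hΘ := h.measurable
    have := Measure.isProbabilityMeasure_map (μ := P) hΘ.aemeasurable
    have hpos := ae_pos_of_Ioi h.pos
    have hX := hN.measurable_increments t 0
    have hdis := disintegrates_condDistrib (P := P) hΘ hX
    have hind := hdis.iIndepFun hΘ hX (X := fun j (z : Fin m → EReal) => z j)
      (fun j => measurable_pi_apply j) (h.cond_indep m t ht)
    have hmS : ∀ j, MeasurableSet {z : Fin m → EReal | z j = (κ j : EReal)} := fun j =>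
      measurableSet_eq_fun (measurable_pi_apply j) measurable_const
    have hd := fun j => ht.sub_nonneg j
    have hmarg : ∀ j, ∀ᵐ θ ∂(P.map Θ), condDistrib (increments N t 0) Θ P θ
        {z : Fin m → EReal | z j = (κ j : EReal)} =
          ENNReal.ofReal (poissonWeight θ ((t j.succ : ℝ) - t j.castSucc) (κ j)) := by
      intro j
      refine hdis.ae_eq hΘ (hmS j) (measurable_poissonWeight_left _ _).ennreal_ofReal ?_
      set δ : ℝ≥0 := t j.succ - t j.castSucc with hδ
      have hδpos : 0 < δ := tsub_pos_of_lt (ht.sub_pos j)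
      have hδcoe : (δ : ℝ) = (t j.succ : ℝ) - t j.castSucc := NNReal.coe_sub (ht.sub_pos j).le
      have hlaw := h.cond_law δ hδpos {(κ j : EReal)} (measurableSet_singleton _)
      have hlaw' : P⟦N δ ⁻¹' {(κ j : EReal)} | sigmaOf Θ⟧ =ᵐ[P] fun ω =>
          (ENNReal.ofReal (poissonWeight (Θ ω) ((t j.succ : ℝ) - t j.castSucc) (κ j))).toReal := by
        filter_upwards [hlaw, ae_of_ae_map hΘ.aemeasurable hpos] with ω h1 h2
        rw [h1, measureReal_def, hδcoe, poissonLaw_singleton h2.le (hd j)]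
      intro D hD
      rw [← (condProb_ae_eq_iff hΘ (hN.measurable δ (measurableSet_singleton _))
        (measurable_poissonWeight_left _ _).ennreal_ofReal
        fun _ => ENNReal.ofReal_ne_top).1 hlaw' D hD]
      have e1 : increments N t 0 ⁻¹' {z : Fin m → EReal | z j = (κ j : EReal)} =
          increments N (pairPartition δ) (t j.castSucc) ⁻¹' {z | z 0 = (κ j : EReal)} := by
        ext ω
        simp only [mem_preimage, mem_ofPred_eq, increments_zero_eq, increments_pairPartition]
        rw [hδ, tsub_add_cancel_of_le (ht.sub_pos j).le]
      have e2 : N δ ⁻¹' {(κ j : EReal)} =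
          increments N (pairPartition δ) 0 ⁻¹' {z | z 0 = (κ j : EReal)} := by
        ext ω
        simp only [mem_preimage, mem_ofPred_eq, increments_pairPartition, add_zero, hN.zero,
          sub_zero, mem_singleton_iff]
      rw [e1, e2]
      -- Stationarity is available for positive shifts; for the shift 0 the two events coincide.
      rcases eq_or_ne (t j.castSucc) 0 with h0 | h0
      · rw [h0]
      · exact h.cond_stationary 1 _ (isPartition_pairPartition hδpos) _ (pos_iff_ne_zero.2 h0) _
          ⟨D, hD, rfl⟩ _
          (measurableSet_eq_fun (measurable_pi_apply (0 : Fin 1)) measurable_const)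
    have e : (⋂ j : Fin m, {ω | N (t j.succ) ω - N (t j.castSucc) ω = (κ j : EReal)}) =
        increments N t 0 ⁻¹' (⋂ j, {z : Fin m → EReal | z j = (κ j : EReal)}) := by
      ext ω
      simp only [mem_preimage, mem_iInter, mem_ofPred_eq, increments_zero_eq]
    rw [e, hdis C _ hC (MeasurableSet.iInter hmS)]
    refine setLIntegral_congr_fun_ae hC ?_
    filter_upwards [hind.meas_iInter (s := fun j => {z : Fin m → EReal | z j = (κ j : EReal)})
      fun j => ⟨{(κ j : EReal)}, measurableSet_singleton _, rfl⟩, ae_all_iff.2 hmarg, hpos]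
      with θ h1 h2 h3 _
    rw [h1, ENNReal.ofReal_prod_of_nonneg fun j _ => poissonWeight_nonneg h3.le (hd j) _]
    exact Finset.prod_congr rfl fun j _ => h2 j

/-- Under the conditional probabilities, a process with conditionally Poisson increments has
independent exponential interarrival times. -/
theorem HasPoissonIncrements.ae_map_interSeq [IsProbabilityMeasure P] (hN : IsCountingProcess N)
    {Θ : Ω → ℝ} (h : HasPoissonIncrements P N Θ) {κ : Kernel ℝ Ω} [IsMarkovKernel κ]
    (hκ : Disintegrates P Θ id κ) :
    ∀ᵐ θ ∂(P.map Θ), 0 < θ ∧ (κ θ).map (interSeq N) = expSeq θ := by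
  have := Measure.isProbabilityMeasure_map (μ := P) h.measurable.aemeasurable
  have hm : Measurable fun ω => fun k => arrival N k ω :=
    measurable_pi_lambda _ hN.measurable_arrival
  have key : ∀ l : List (ℚ × ℕ), (∀ p ∈ l, 0 < p.1) → ∀ᵐ θ ∂(P.map Θ),
      κ θ {ω | (fun k => arrival N k ω) ∈ counts 0 0 (ratList l)} =
        ENNReal.ofReal (listWeight θ (ratList l)) := by
    intro l hl
    obtain ⟨t, c, h0, hmono, hgap⟩ := exists_partition_of_list (ratList l) (ratList_pos hl) 0
    rw [← hgap, ← hN.increments_event_eq t h0]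
    simp_rw [listWeight_gapList]
    refine hκ.ae_eq h.measurable ?_ ?_ fun C hC => h.measure_inter _ t ⟨h0, hmono⟩ c C hC
    · rw [hN.increments_event_eq t h0]
      exact hm (measurableSet_counts _ _ _)
    · exact (Finset.measurable_prod _ fun j _ => measurable_poissonWeight_left _ _).ennreal_ofReal
  have key' : ∀ᵐ θ ∂(P.map Θ), ∀ l : List (ℚ × ℕ), (∀ p ∈ l, 0 < p.1) →
      κ θ {ω | (fun k => arrival N k ω) ∈ counts 0 0 (ratList l)} =
        ENNReal.ofReal (listWeight θ (ratList l)) :=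
    -- Lists with rational gaps are countable, so one null set serves them all.
    ae_all_iff.2 fun l => eventually_imp_distrib_left.2 (key l)
  filter_upwards [key', ae_pos_of_Ioi h.pos] with θ h1 h2
  refine ⟨h2, ?_⟩
  rw [← mixLaw_dirac h2]
  refine hN.map_interSeq_eq_mixLaw (κ θ) (by simp [h2]) fun l hl => ?_
  rw [lintegral_dirac, h1 l hl]

end MixedPoisson

/-! ### Loss of memory for mixtures of i.i.d. sequences -/

namespace MixedPoisson

/-- A distribution on the positive half line without memory at the rational times is exponential. -/
theorem eq_expMeasure_of_memoryless {ν : Measure ℝ} [IsProbabilityMeasure ν] (h0 : ν (Ioi 0) = 1)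
    (h : ∀ s t : ℚ, 0 ≤ s → 0 ≤ t →
      ν (Ioi ((s : ℝ) + t)) = ν (Ioi (s : ℝ)) * ν (Ioi (t : ℝ))) :
    0 < -Real.log (ν (Ioi 1)).toReal ∧ ν = expMeasure (-Real.log (ν (Ioi 1)).toReal) := by
  let F : ℚ → ℝ := fun q => (ν (Ioi (q : ℝ))).toReal
  have hF1 : F 1 = (ν (Ioi 1)).toReal := by simp [F]
  have hF0 : F 0 = 1 := by simp [F, h0]
  have hFnn : ∀ q, 0 ≤ F q := fun q => ENNReal.toReal_nonneg
  have hmul : ∀ s t : ℚ, 0 ≤ s → 0 ≤ t → F (s + t) = F s * F t := by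
    intro s t hs ht
    simp only [F]
    rw [← ENNReal.toReal_mul, ← h s t hs ht]
    push_cast
    rfl
  have hpow : ∀ (n : ℕ) (q : ℚ), 0 ≤ q → F (n * q) = F q ^ n := by
    intro n q hq
    induction n with
    | zero => simp [hF0]
    | succ n ih =>
      rw [pow_succ, ← ih, ← hmul _ _ (by positivity) hq]
      congr 1
      push_cast
      ring
  -- If `F 1` vanished, so would `F` at every `1 / (n + 1)`, and the half-line of positive numbers
  -- would be null.
  have hpos : 0 < F 1 := by
    refine lt_of_le_of_ne (hFnn 1) fun h1 => ?_
    have hz : ∀ n : ℕ, ν (Ioi ((1 : ℝ) / (n + 1))) = 0 := by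
      intro n
      have h2 := hpow (n + 1) (1 / (n + 1 : ℕ)) (by positivity)
      rw [mul_one_div_cancel (by positivity), ← h1] at h2
      have h3 : F (1 / (n + 1 : ℕ)) = 0 := eq_zero_of_pow_eq_zero h2.symm
      have h4 := (ENNReal.toReal_eq_zero_iff _).1 h3
      rcases h4 with h4 | h4
      · rw [← h4]
        push_cast
        rfl
      · exact absurd h4 (measure_ne_top _ _)
    have hU : Ioi (0 : ℝ) ⊆ ⋃ n : ℕ, Ioi ((1 : ℝ) / (n + 1)) := fun x hx => by
      obtain ⟨n, hn⟩ := exists_nat_one_div_lt (mem_Ioi.1 hx)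
      exact mem_iUnion.2 ⟨n, hn⟩
    have := measure_mono_null hU (measure_iUnion_null hz)
    rw [h0] at this
    exact one_ne_zero this
  -- If `F 1` were one, all mass would lie beyond every natural number.
  have hlt : F 1 < 1 := by
    have hle : F 1 ≤ 1 := by
      rw [hF1]
      exact ENNReal.toReal_le_of_le_ofReal zero_le_one (by simpa using prob_le_one)
    refine lt_of_le_of_ne hle fun h1 => ?_
    have hone : ∀ n : ℕ, ν (Ioi (n : ℝ)) = 1 := by
      intro n
      have h2 := hpow n 1 zero_le_one
      rw [h1, one_pow, mul_one] at h2
      have := (ENNReal.toReal_eq_one_iff _).1 h2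
      simpa using this
    have hanti : Antitone fun n : ℕ => Ioi (n : ℝ) := fun a b hab =>
      Ioi_subset_Ioi (by exact_mod_cast hab)
    have hlim := tendsto_measure_iInter_atTop (μ := ν)
      (fun n : ℕ => (measurableSet_Ioi (a := (n : ℝ))).nullMeasurableSet) hanti
      ⟨0, measure_ne_top _ _⟩
    have hemp : (⋂ n : ℕ, Ioi (n : ℝ)) = ∅ := by
      refine eq_empty_iff_forall_notMem.2 fun x hx => ?_
      obtain ⟨n, hn⟩ := exists_nat_gt x
      exact lt_asymm hn (mem_iInter.1 hx n)
    simp only [hone, hemp, measure_empty, Function.comp_def] at hlim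
    exact one_ne_zero (tendsto_nhds_unique tendsto_const_nhds hlim)
  rw [← hF1]
  have hlog : 0 < -Real.log (F 1) := neg_pos.2 (Real.log_neg hpos hlt)
  refine ⟨hlog, eq_expMeasure_of_Ioi hlog fun q hq => ?_⟩
  -- Raise to the power of the denominator of `q`: both sides become the power of `F 1` given by the
  -- numerator.
  have hFq : F q = Real.exp (-(-Real.log (F 1)) * q) := by
    have h1 := hpow q.den q hq
    have hnum : (q.den : ℚ) * q = (q.num.toNat : ℕ) * 1 := by
      rw [mul_one, Rat.den_mul_eq_num]
      have := Int.toNat_of_nonneg (Rat.num_nonneg.2 hq)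
      exact_mod_cast this.symm
    rw [hnum, hpow _ 1 zero_le_one] at h1
    have hnum' : (q.den : ℝ) * q = q.num.toNat := by
      have : (q.den : ℚ) * q = (q.num.toNat : ℚ) := by rw [hnum, mul_one]
      exact_mod_cast this
    refine (pow_left_inj₀ (hFnn q) (Real.exp_pos _).le q.den_nz).1 ?_
    rw [← h1, neg_neg, ← Real.exp_nat_mul, mul_left_comm, hnum', mul_comm, Real.exp_nat_mul,
      Real.exp_log hpos]
  rw [← hFq, ENNReal.ofReal_toReal (measure_ne_top _ _)]

/-- Two functions with values in `[0, 1]` whose second moments and mixed second moment agree are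
equal almost everywhere. -/
theorem ae_eq_of_lintegral_mul_eq {Y : Type*} [MeasurableSpace Y] {μ : Measure Y}
    [IsProbabilityMeasure μ] {f g : Y → ℝ≥0∞} (hf : Measurable f) (hg : Measurable g)
    (hf1 : ∀ y, f y ≤ 1) (hg1 : ∀ y, g y ≤ 1)
    (hff : ∫⁻ y, f y * f y ∂μ = ∫⁻ y, f y * g y ∂μ)
    (hgg : ∫⁻ y, g y * g y ∂μ = ∫⁻ y, f y * g y ∂μ) : f =ᵐ[μ] g := by
  have hint : ∀ a b : Y → ℝ≥0∞, Measurable a → Measurable b → (∀ y, a y ≤ 1) → (∀ y, b y ≤ 1) →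
      Integrable (fun y => (a y).toReal * (b y).toReal) μ ∧
      ∫ y, (a y).toReal * (b y).toReal ∂μ = (∫⁻ y, a y * b y ∂μ).toReal := by
    intro a b ha hb ha1 hb1
    have hle : ∀ y, a y * b y ≤ 1 := fun y => mul_le_one' (ha1 y) (hb1 y)
    simp_rw [← ENNReal.toReal_mul]
    constructor
    · refine integrable_toReal_of_lintegral_ne_top (ha.mul hb).aemeasurable ?_
      refine ((lintegral_mono hle).trans_lt ?_).ne
      simp
    · exact integral_toReal (ha.mul hb).aemeasurable
        (ae_of_all _ fun y => (hle y).trans_lt ENNReal.one_lt_top)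
  obtain ⟨i1, e1⟩ := hint f f hf hf hf1 hf1
  obtain ⟨i2, e2⟩ := hint f g hf hg hf1 hg1
  obtain ⟨i3, e3⟩ := hint g g hg hg hg1 hg1
  have hsq : ∀ y, ((f y).toReal - (g y).toReal) ^ 2 = (f y).toReal * (f y).toReal -
      2 * ((f y).toReal * (g y).toReal) + (g y).toReal * (g y).toReal := fun y => by ring
  -- The hypotheses make all three terms of the expanded square equal up to the coefficients 1, -2,
  -- 1.
  have hzero : ∫ y, ((f y).toReal - (g y).toReal) ^ 2 ∂μ = 0 := by
    simp_rw [hsq]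
    have e4 := integral_sub i1 (i2.const_mul 2)
    have e5 := integral_add (i1.sub (i2.const_mul 2)) i3
    simp only [Pi.sub_apply] at e5
    rw [e5, e4, integral_const_mul, e1, e2, e3, hff, hgg]
    ring
  have hi : Integrable (fun y => ((f y).toReal - (g y).toReal) ^ 2) μ := by
    simp_rw [hsq]
    exact (i1.sub (i2.const_mul 2)).add i3
  have := (integral_eq_zero_iff_of_nonneg (fun y => sq_nonneg _) hi).1 hzero
  filter_upwards [this] with y hy
  have hy' : (f y).toReal - (g y).toReal = 0 := by simpa using hy
  rwa [sub_eq_zero, ENNReal.toReal_eq_toReal_iff' ((hf1 y).trans_lt ENNReal.one_lt_top).ne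
    ((hg1 y).trans_lt ENNReal.one_lt_top).ne] at hy'

theorem infinitePi_iInter_le {ν : Measure ℝ} [IsProbabilityMeasure ν] (s : Finset ℕ) (q : ℕ → ℝ) :
    Measure.infinitePi (fun _ : ℕ => ν) (⋂ k ∈ s, {x | x k ≤ q k}) = ∏ k ∈ s, ν (Iic (q k)) := by
  rw [← Measure.infinitePi_pi (fun _ : ℕ => ν) (s := s) (t := fun k => Iic (q k))
    fun _ _ => measurableSet_Iic]
  congr 1
  ext x
  simp

theorem infinitePi_iInter_fin_le {ν : Measure ℝ} [IsProbabilityMeasure ν] (r : ℕ)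
    (w : Fin r → ℝ) :
    Measure.infinitePi (fun _ : ℕ => ν) (⋂ k : Fin r, {x | x k ≤ w k}) =
      ∏ k : Fin r, ν (Iic (w k)) := by
  have := infinitePi_iInter_le (ν := ν) (Finset.range r) fun k => if h : k < r then w ⟨k, h⟩ else 0
  rw [Finset.prod_range] at this
  simp only [Fin.is_lt, dite_true] at this
  rw [← this]
  congr 1
  ext x
  simp only [mem_iInter, mem_ofPred_eq, Finset.mem_range]
  constructor
  · intro h k hk
    rw [dif_pos hk]
    exact h ⟨k, hk⟩
  · intro h k
    have := h k k.2
    rwa [dif_pos k.2] at this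

/-- If a mixture of sequences of independent and identically distributed random variables is a
mixture of sequences of independent exponential random variables, then almost all of the
distributions are without memory. -/
theorem ae_memoryless_of_mixture {Y : Type*} [MeasurableSpace Y] {μ : Measure Y}
    [IsProbabilityMeasure μ] {ν : Y → Measure ℝ} (hν : ∀ y, IsProbabilityMeasure (ν y))
    (hνm : ∀ B, MeasurableSet B → Measurable fun y => ν y B) {U : Measure ℝ}
    [IsProbabilityMeasure U] (hU : U (Ioi 0) = 1)
    (h : ∀ A : Set (ℕ → ℝ), MeasurableSet A →
      ∫⁻ y, Measure.infinitePi (fun _ : ℕ => ν y) A ∂μ = mixLaw U A) :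
    ∀ᵐ y ∂μ, ∀ s t : ℚ, 0 ≤ s → 0 ≤ t →
      ν y (Ioi ((s : ℝ) + t)) = ν y (Ioi (s : ℝ)) * ν y (Ioi (t : ℝ)) := by
  have hbox : ∀ (r : ℕ) (c : ℕ → ℝ), (∀ i, 0 ≤ c i) →
      ∫⁻ y, ∏ i ∈ Finset.range r, ν y (Ioi (c i)) ∂μ =
        ∫⁻ u, ∏ i ∈ Finset.range r, ENNReal.ofReal (Real.exp (-u * c i)) ∂U := by
    intro r c hc
    have hm : MeasurableSet (Set.pi (Finset.range r : Set ℕ) fun i => Ioi (c i)) :=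
      MeasurableSet.pi (Finset.range r).countable_toSet fun _ _ => measurableSet_Ioi
    have h1 := h _ hm
    rw [mixLaw_apply hU hm] at h1
    simp_rw [Measure.infinitePi_pi _ fun _ _ => measurableSet_Ioi] at h1
    rw [h1]
    refine lintegral_congr_ae ?_
    filter_upwards [ae_pos_of_Ioi hU] with u hu
    have := isProbabilityMeasure_expMeasure hu
    rw [expSeq, Measure.infinitePi_pi _ fun _ _ => measurableSet_Ioi]
    exact Finset.prod_congr rfl fun i _ => expMeasure_Ioi hu (hc i)
  refine ae_all_iff.2 fun s => ae_all_iff.2 fun t => ?_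
  by_cases hst : 0 ≤ s ∧ 0 ≤ t
  · have hs : (0 : ℝ) ≤ s := by exact_mod_cast hst.1
    have ht : (0 : ℝ) ≤ t := by exact_mod_cast hst.2
    have hget : ∀ l : List ℝ, (∀ x ∈ l, 0 ≤ x) → ∀ i, 0 ≤ l.getD i 0 := by
      intro l hl i
      rw [List.getD_eq_getElem?_getD]
      rcases hx : l[i]? with _ | x
      · simp
      · exact hl x (List.mem_of_getElem? hx)
    have e : ∀ u : ℝ, Real.exp (-u * (s + t)) = Real.exp (-u * s) * Real.exp (-u * t) := by
      intro u
      rw [← Real.exp_add]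
      ring_nf
    -- For f = G(s+t) and g = G(s)G(t), with G the tail of `ν y`, the integrals of f², fg and g² are
    -- tail probabilities of two, three and four coordinates. On the exponential side all three
    -- equal the integral of exp(-2u(s+t)).
    have h2 := hbox 2 (fun i => [(s : ℝ) + t, s + t].getD i 0)
      (hget _ (by simp; positivity))
    have h3 := hbox 3 (fun i => [(s : ℝ) + t, s, t].getD i 0)
      (hget _ (by simp [hs, ht]; positivity))
    have h4 := hbox 4 (fun i => [(s : ℝ), t, s, t].getD i 0) (hget _ (by simp [hs, ht]))
    simp only [Finset.prod_range_succ, Finset.prod_range_zero, one_mul, List.getD_cons_zero,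
      List.getD_cons_succ, e, ENNReal.ofReal_mul (Real.exp_pos _).le] at h2 h3 h4
    have h5 : ∀ᵐ y ∂μ, ν y (Ioi ((s : ℝ) + t)) = ν y (Ioi (s : ℝ)) * ν y (Ioi (t : ℝ)) := by
      refine ae_eq_of_lintegral_mul_eq (hνm _ measurableSet_Ioi)
        ((hνm _ measurableSet_Ioi).mul (hνm _ measurableSet_Ioi)) (fun y => prob_le_one)
        (fun y => mul_le_one' prob_le_one prob_le_one) ?_ ?_
      · simp_rw [← mul_assoc]
        rw [h2, h3]
        simp_rw [← mul_assoc]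
      · simp_rw [← mul_assoc]
        rw [h4, h3]
    filter_upwards [h5] with y hy _ _ using hy
  · exact ae_of_all _ fun y h1 h2 => absurd ⟨h1, h2⟩ hst

variable {Ω : Type u} [MeasurableSpace Ω] {P : Measure Ω} {N : ℝ≥0 → Ω → EReal}

/-- The interarrival times of a mixed renewal process are independent and identically distributed
under the conditional probabilities. -/
theorem IsExtendedMRP.ae_map_interSeq [IsProbabilityMeasure P] (hN : IsCountingProcess N)
    {D : Set ℝ} {Θ : Ω → D} {h : D → ℝ} {K : ℝ → Measure ℝ} (hR : IsExtendedMRP P N Θ h K)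
    {κ : Kernel D Ω} [IsMarkovKernel κ] (hκ : Disintegrates P Θ id κ) :
    ∀ᵐ θ ∂(P.map Θ), (κ θ).map (interSeq N) = Measure.infinitePi fun _ : ℕ => K (h θ) := by
  have hΘ := hR.measurable_param
  have hmarg : ∀ (n : ℕ) (x : ℝ), ∀ᵐ θ ∂(P.map Θ),
      κ θ {ω | interarrival N n ω ≤ x} = K (h θ) (Iic x) := by
    intro n x
    have hm : MeasurableSet {ω | interarrival N n ω ≤ x} :=
      measurableSet_le (hN.measurable_interarrival n) measurable_const
    have hK := hR.prob
    refine hκ.ae_eq hΘ hm (hR.measurable_K _ measurableSet_Iic) ?_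
    exact (condProb_ae_eq_iff hΘ hm (hR.measurable_K _ measurableSet_Iic)
      fun _ => measure_ne_top _ _).1 (hR.cond_law n (Iic x) measurableSet_Iic)
  have hbox : ∀ (s : Finset ℕ) (q : ℕ → ℝ), ∀ᵐ θ ∂(P.map Θ),
      κ θ (⋂ k ∈ s, {ω | interarrival N k ω ≤ q k}) = ∏ k ∈ s, K (h θ) (Iic (q k)) := by
    intro s q
    filter_upwards [hκ.ae_iInter_le hΘ measurable_id hN.measurable_interarrival hR.cond_indep s q,
      ae_all_iff.2 fun k => hmarg k (q k)] with θ h1 h2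
    rw [h1]
    exact Finset.prod_congr rfl fun k _ => h2 k
  -- The bounds are indexed by `s` and extended by 0, since functions on a finite set with rational
  -- values are countable while those on `ℕ` are not.
  have hall : ∀ᵐ θ ∂(P.map Θ), ∀ (s : Finset ℕ) (q : s → ℚ),
      κ θ (⋂ k ∈ s, {ω | interarrival N k ω ≤ if hk : k ∈ s then (q ⟨k, hk⟩ : ℝ) else 0}) =
        ∏ k ∈ s, K (h θ) (Iic (if hk : k ∈ s then (q ⟨k, hk⟩ : ℝ) else 0)) :=
    ae_all_iff.2 fun s => ae_all_iff.2 fun q => hbox s _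
  filter_upwards [hall] with θ hθ
  have := hR.prob θ
  have := Measure.isProbabilityMeasure_map (μ := κ θ) hN.measurable_interSeq.aemeasurable
  refine ext_of_forall_iInter_le fun s q => ?_
  have hm : MeasurableSet (⋂ k ∈ s, {x : ℕ → ℝ | x k ≤ q k}) :=
    Finset.measurableSet_biInter _ fun k _ =>
      measurableSet_le (measurable_pi_apply k) measurable_const
  have h1 := hθ s fun k => q k
  rw [infinitePi_iInter_le, Measure.map_apply hN.measurable_interSeq hm]
  have h2 : ∏ k ∈ s, K (h θ) (Iic (q k)) =
      ∏ k ∈ s, K (h θ) (Iic (if hk : k ∈ s then (q k : ℝ) else 0)) :=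
    Finset.prod_congr rfl fun k hk => by rw [dif_pos hk]
  rw [h2, ← h1]
  congr 1
  ext ω
  simp only [mem_preimage, mem_iInter, mem_ofPred_eq, interSeq]
  exact forall₂_congr fun k hk => by rw [dif_pos hk]

/-- A mixed renewal process whose interarrival times have the joint distribution of those of a mixed
Poisson process has conditionally Poisson increments. -/
theorem IsExtendedMRP.exists_hasPoissonIncrements [IsProbabilityMeasure P]
    (hN : IsCountingProcess N) {D : Set ℝ} {Θ : Ω → D} {h : D → ℝ} {K : ℝ → Measure ℝ}
    (hR : IsExtendedMRP P N Θ h K) {κ : Kernel D Ω} [IsMarkovKernel κ]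
    (hκ : Disintegrates P Θ id κ) {U : Measure ℝ} [IsProbabilityMeasure U] (hU : U (Ioi 0) = 1)
    (hlaw : P.map (interSeq N) = mixLaw U) :
    ∃ Θ' : Ω → ℝ, HasPoissonIncrements P N Θ' := by
  have hΘ := hR.measurable_param
  have hprobΘ := Measure.isProbabilityMeasure_map (μ := P) hΘ.aemeasurable
  have hK := hR.prob
  have hW := hN.measurable_interSeq
  have hiid := hR.ae_map_interSeq hN hκ
  have hmem := ae_memoryless_of_mixture (μ := P.map Θ) hK hR.measurable_K hU fun A hA => by
    rw [← hlaw, Measure.map_apply hW hA]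
    have h1 := hκ univ _ MeasurableSet.univ (hW hA)
    simp only [preimage_univ, univ_inter, preimage_id, Measure.restrict_univ] at h1
    rw [h1]
    refine lintegral_congr_ae ?_
    filter_upwards [hiid] with θ hθ
    rw [← hθ, Measure.map_apply hW hA]
  -- The rate of an exponential law is minus the logarithm of its tail at 1. Composed with `Θ` it is
  -- the new mixing parameter.
  let rate : D → ℝ := fun θ => -Real.log (K (h θ) (Ioi 1)).toReal
  have hrate : Measurable rate :=
    (Real.measurable_log.comp (hR.measurable_K _ measurableSet_Ioi).ennreal_toReal).neg
  have hexp : ∀ᵐ θ ∂(P.map Θ), 0 < rate θ ∧ (κ θ).map (interSeq N) = expSeq (rate θ) := by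
    filter_upwards [hiid, hmem] with θ h1 h2
    -- Paths have strictly positive interarrival times, and the common marginal inherits this.
    have h0 : K (h θ) (Ioi 0) = 1 := by
      rw [← Measure.infinitePi_map_eval (fun _ : ℕ => K (h θ)) 0, ← h1,
        Measure.map_map (measurable_pi_apply 0) hW,
        Measure.map_apply ((measurable_pi_apply 0).comp hW) measurableSet_Ioi]
      have : (fun x : ℕ → ℝ => x 0) ∘ interSeq N ⁻¹' Ioi 0 = univ :=
        eq_univ_of_forall fun ω => hN.interarrival_pos 0 ω
      rw [this, measure_univ]
    obtain ⟨h3, h4⟩ := eq_expMeasure_of_memoryless h0 h2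
    refine ⟨h3, ?_⟩
    rw [h1, expSeq, ← h4]
  have hmap : P.map (fun ω => rate (Θ ω)) = (P.map Θ).map rate :=
    (Measure.map_map hrate hΘ).symm
  refine ⟨fun ω => rate (Θ ω), hrate.comp hΘ, ?_, fun m t ht c C hC => ?_⟩
  · rw [hmap, Measure.map_apply hrate measurableSet_Ioi]
    refine (mem_ae_iff_prob_eq_one (hrate measurableSet_Ioi)).1 ?_
    filter_upwards [hexp] with θ hθ using hθ.1
  · have hm : Measurable fun θ : ℝ => ENNReal.ofReal (∏ j : Fin m,
        poissonWeight θ ((t j.succ : ℝ) - t j.castSucc) (c j)) :=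
      (Finset.measurable_prod _ fun j _ => measurable_poissonWeight_left _ _).ennreal_ofReal
    have hE : MeasurableSet
        (⋂ j : Fin m, {ω | N (t j.succ) ω - N (t j.castSucc) ω = (c j : EReal)}) :=
      MeasurableSet.iInter fun j => hN.measurable_sub _ _ (measurableSet_singleton _)
    have h1 := hκ (rate ⁻¹' C) _ (hrate hC) hE
    rw [hmap, setLIntegral_map hC hm hrate]
    refine Eq.trans h1 (setLIntegral_congr_fun_ae (hrate hC) ?_)
    filter_upwards [hexp] with θ hθ _
    exact hN.increments_of_expSeq hθ.1 hθ.2 t ht c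

end MixedPoisson

/-! ### The implications between the four assertions -/

namespace MixedPoisson

variable {Ω : Type u} [MeasurableSpace Ω] {P : Measure Ω} {N : ℝ≥0 → Ω → EReal}

theorem poissonWeight_le_one {θ d : ℝ} (hθ : 0 ≤ θ) (hd : 0 ≤ d) (k : ℕ) :
    poissonWeight θ d k ≤ 1 := by
  rw [← ENNReal.ofReal_le_one, poissonWeight_eq_poissonMeasure hθ hd]
  exact prob_le_one

/-- The mixture formula for the increments in terms of the Lebesgue integral. -/
theorem lintegral_poissonWeight_eq {U : Measure ℝ} [IsProbabilityMeasure U] (hU : U (Ioi 0) = 1)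
    {m : ℕ} {t : Fin (m + 1) → ℝ≥0} (ht : IsPartition t) (κ : Fin m → ℕ) :
    ∫⁻ θ, ENNReal.ofReal (∏ j : Fin m,
        poissonWeight θ ((t j.succ : ℝ) - t j.castSucc) (κ j)) ∂U =
      ENNReal.ofReal (∫ θ in Ioi (0 : ℝ), ∏ j : Fin m,
        poissonWeight θ ((t j.succ : ℝ) - t j.castSucc) (κ j) ∂U) := by
  have hm : Measurable fun θ : ℝ => ∏ j : Fin m,
      poissonWeight θ ((t j.succ : ℝ) - t j.castSucc) (κ j) :=
    Finset.measurable_prod _ fun j _ => measurable_poissonWeight_left _ _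
  rw [Measure.restrict_eq_self_of_ae_mem (s := Ioi (0 : ℝ)) (ae_pos_of_Ioi hU),
    ofReal_integral_eq_lintegral_ofReal]
  · refine Integrable.of_bound hm.aestronglyMeasurable 1 ?_
    filter_upwards [ae_pos_of_Ioi hU] with θ hθ
    rw [Real.norm_of_nonneg
      (Finset.prod_nonneg fun j _ => poissonWeight_nonneg hθ.le (ht.sub_nonneg j) _)]
    exact Finset.prod_le_one (fun j _ => poissonWeight_nonneg hθ.le (ht.sub_nonneg j) _)
      fun j _ => poissonWeight_le_one hθ.le (ht.sub_nonneg j) _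
  · filter_upwards [ae_pos_of_Ioi hU] with θ hθ
    exact Finset.prod_nonneg fun j _ => poissonWeight_nonneg hθ.le (ht.sub_nonneg j) _

theorem integral_prod_poissonWeight_nonneg (U : Measure ℝ) {m : ℕ} {t : Fin (m + 1) → ℝ≥0}
    (ht : IsPartition t) (κ : Fin m → ℕ) :
    0 ≤ ∫ θ in Ioi (0 : ℝ), ∏ j : Fin m,
      poissonWeight θ ((t j.succ : ℝ) - t j.castSucc) (κ j) ∂U :=
  setIntegral_nonneg measurableSet_Ioi fun _ hθ =>
    Finset.prod_nonneg fun j _ => poissonWeight_nonneg (mem_Ioi.1 hθ).le (ht.sub_nonneg j) _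

theorem HasPoissonIncrements.isMPPDistribution [IsProbabilityMeasure P] {Θ : Ω → ℝ}
    (h : HasPoissonIncrements P N Θ) : IsMPPDistribution P N (P.map Θ) where
  prob := Measure.isProbabilityMeasure_map h.measurable.aemeasurable
  pos := h.pos
  mixture m t ht κ := by
    have := Measure.isProbabilityMeasure_map (μ := P) h.measurable.aemeasurable
    have h1 := h.measure_inter m t ht κ univ MeasurableSet.univ
    rw [preimage_univ, univ_inter, Measure.restrict_univ, lintegral_poissonWeight_eq h.pos ht] at h1
    rw [measureReal_def, h1, ENNReal.toReal_ofReal (integral_prod_poissonWeight_nonneg _ ht κ)]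
    rfl

theorem IsMPPDistribution.map_interSeq [IsProbabilityMeasure P] (hN : IsCountingProcess N)
    {U : Measure ℝ} (h : IsMPPDistribution P N U) : P.map (interSeq N) = mixLaw U := by
  have := h.prob
  refine hN.map_interSeq_of_increments P h.pos fun m t ht κ => ?_
  rw [lintegral_poissonWeight_eq h.pos ht, ← ENNReal.ofReal_toReal (measure_ne_top P _)]
  exact congrArg ENNReal.ofReal (h.mixture m t ht κ)

theorem expMeasure_Iic {θ : ℝ} (hθ : 0 < θ) {t : ℝ} (ht : 0 ≤ t) :
    expMeasure θ (Iic t) = 1 - ENNReal.ofReal (Real.exp (-θ * t)) := by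
  have := isProbabilityMeasure_expMeasure hθ
  rw [← compl_Ioi, prob_compl_eq_one_sub measurableSet_Ioi, expMeasure_Ioi hθ ht]

/-- The interarrival times of a mixed Poisson process associated with a family of probability
measures are mixtures of independent exponential random variables. -/
theorem IsMPPFamily.exists_map_interSeq [IsProbabilityMeasure P] (hN : IsCountingProcess N)
    {Y : Type v} {Q : Y → Measure Ω} {ν : @Measure Y (familySigma Q)} (h : IsMPPFamily P N Q ν) :
    ∃ U : Measure ℝ, IsProbabilityMeasure U ∧ U (Ioi 0) = 1 ∧ P.map (interSeq N) = mixLaw U := by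
  let _ : MeasurableSpace Y := familySigma Q
  obtain ⟨α, hpos, hα, hexp⟩ := h.exponential
  have : IsProbabilityMeasure ν := ⟨h.prob_mixing⟩
  have hU := Measure.isProbabilityMeasure_map (μ := ν) hα.aemeasurable
  have hU0 : ν.map α (Ioi 0) = 1 := by
    rw [Measure.map_apply hα measurableSet_Ioi,
      eq_univ_of_forall (s := α ⁻¹' Ioi 0) fun y => hpos y, measure_univ]
  have := Measure.isProbabilityMeasure_map (μ := P) hN.measurable_interSeq.aemeasurable
  refine ⟨ν.map α, hU, hU0, ext_of_forall_iInter_fin_le fun r w => ?_⟩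
  have hmS : MeasurableSet (⋂ k : Fin r, {x : ℕ → ℝ | x k ≤ w k}) :=
    MeasurableSet.iInter fun k => measurableSet_le (measurable_pi_apply _) measurable_const
  -- The mixture formula covers positive bounds; with a bound at most 0 both sides vanish because
  -- interarrival times are positive.
  by_cases hw : ∀ k, 0 < w k
  · have h1 : P.map (interSeq N) (⋂ k : Fin r, {x : ℕ → ℝ | x k ≤ w k}) =
        P (⋂ k : Fin r, {ω | interarrival N k ω ≤ w k}) := by
      rw [Measure.map_apply hN.measurable_interSeq hmS]
      congr 1
      ext ω
      simp [interSeq]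
    have hm : Measurable fun u : ℝ =>
        ∏ k : Fin r, (1 - ENNReal.ofReal (Real.exp (-u * w k))) := by fun_prop
    have h2 : mixLaw (ν.map α) (⋂ k : Fin r, {x : ℕ → ℝ | x k ≤ w k}) =
        ∫⁻ y, ∏ k : Fin r, (1 - ENNReal.ofReal (Real.exp (-(α y) * w k))) ∂ν := by
      rw [mixLaw_apply hU0 hmS, ← lintegral_map hm hα]
      refine lintegral_congr_ae ?_
      filter_upwards [ae_pos_of_Ioi hU0] with u hu
      have := isProbabilityMeasure_expMeasure hu
      rw [expSeq, infinitePi_iInter_fin_le]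
      exact Finset.prod_congr rfl fun k _ => expMeasure_Iic hu (hw k).le
    rw [h1, h2, h.mixture r w hw]
    refine lintegral_congr_ae ?_
    filter_upwards [hexp] with y hy
    refine Finset.prod_congr rfl fun k _ => ?_
    rw [← expMeasure_Iic (hpos y) (hw k).le, ← hy.2 k,
      Measure.map_apply (hN.measurable_interarrival k) measurableSet_Iic]
    rfl
  · push Not at hw
    obtain ⟨k, hk⟩ := hw
    have h1 : P.map (interSeq N) (⋂ k : Fin r, {x : ℕ → ℝ | x k ≤ w k}) = 0 := by
      rw [Measure.map_apply hN.measurable_interSeq hmS]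
      refine measure_mono_null (t := ∅) (fun ω hω => ?_) measure_empty
      have h2 : interarrival N k ω ≤ w k := mem_iInter.1 hω k
      exact absurd (h2.trans hk) (not_le.2 (hN.interarrival_pos k ω))
    rw [h1]
    refine (measure_mono_null (fun x hx hpos => ?_) (ae_iff.1 (ae_mixLaw_pos hU0))).symm
    have h2 : x k ≤ w k := mem_iInter.1 hx k
    exact absurd (h2.trans hk) (not_le.2 (hpos k))

theorem measurable_listWeight (l : List (ℝ × ℕ)) : Measurable fun θ => listWeight θ l := by
  induction l with
  | nil => simp [listWeight]
  | cons p l ih =>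
    simp_rw [listWeight_cons]
    exact (measurable_poissonWeight_left _ _).mul ih

/-- Conditional probabilities under which the interarrival times are independent and exponential
provide a family of probability measures with which the process is associated. -/
theorem hasMixingFamily_of_disintegrates [IsProbabilityMeasure P] (hN : IsCountingProcess N)
    {Θ : Ω → ℝ} (hΘ : Measurable Θ) {κ : Kernel ℝ Ω} [IsMarkovKernel κ]
    (hκ : Disintegrates P Θ id κ)
    (hlaw : ∀ᵐ θ ∂(P.map Θ), 0 < θ ∧ (κ θ).map (interSeq N) = expSeq θ) :
    HasMixingFamily.{u, v} P N := by
  have := Measure.isProbabilityMeasure_map (μ := P) hΘ.aemeasurable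
  -- The lift places the index set in the prescribed universe.
  let Q : ULift.{v} ℝ → Measure Ω := fun y => κ y.down
  have hQm : ∀ E, MeasurableSet E → Measurable[familySigma Q] fun y => Q y E := fun E hE =>
    Measurable.of_comap_le (le_iSup₂_of_le E hE le_rfl)
  have hup : @Measurable ℝ (ULift.{v} ℝ) _ (familySigma Q) ULift.up := by
    refine Measurable.of_le_map (iSup₂_le fun E hE => ?_)
    rw [MeasurableSpace.comap_le_iff_le_map, MeasurableSpace.map_comp]
    exact (Kernel.measurable_coe κ hE).le_map
  let _ : MeasurableSpace (ULift.{v} ℝ) := familySigma Q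
  let ν : Measure (ULift.{v} ℝ) := (P.map Θ).map ULift.up
  have hν : IsProbabilityMeasure ν := Measure.isProbabilityMeasure_map hup.aemeasurable
  -- The rate must be measurable for the σ-algebra generated by the family, so it is recovered from
  -- the probability of an event instead of from the index.
  let a : ULift.{v} ℝ → ℝ := fun y => -Real.log (Q y {ω | 1 < interarrival N 0 ω}).toReal
  have hW1 : MeasurableSet {ω | 1 < interarrival N 0 ω} :=
    measurableSet_lt measurable_const (hN.measurable_interarrival 0)
  have ha : Measurable a := (Real.measurable_log.comp (hQm _ hW1).ennreal_toReal).neg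
  -- The default value 1 keeps the rate positive at every index; it is used only on a null set.
  let α : ULift.{v} ℝ → ℝ := fun y => if 0 < a y then a y else 1
  have hα : Measurable α :=
    Measurable.ite (measurableSet_lt measurable_const ha) ha measurable_const
  have hαpos : ∀ y, 0 < α y := fun y => by
    by_cases hy : 0 < a y
    · simp [α, hy]
    · simp [α, hy]
  have hαeq : ∀ᵐ θ ∂(P.map Θ), α (ULift.up θ) = θ := by
    filter_upwards [hlaw] with θ hθ
    have h1 := (hN.iIndepFun_interarrival hθ.1 hθ.2).2 0
    have h2 : Q (ULift.up θ) {ω | 1 < interarrival N 0 ω} = ENNReal.ofReal (Real.exp (-θ)) := by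
      have h3 := expMeasure_Ioi hθ.1 zero_le_one
      rw [mul_one, ← h1, Measure.map_apply (hN.measurable_interarrival 0) measurableSet_Ioi] at h3
      exact h3
    have h4 : a (ULift.up θ) = θ := by
      simp only [a, h2, ENNReal.toReal_ofReal (Real.exp_pos _).le, Real.log_exp, neg_neg]
    simp only [α, h4, if_pos hθ.1]
  refine ⟨ULift.{v} ℝ, Q, ν, fun y => inferInstanceAs (IsProbabilityMeasure (κ y.down)),
    measure_univ, fun r w _ => ?_, α, hαpos, hα, ?_⟩
  · have hE : ∀ k : Fin r, MeasurableSet {ω | interarrival N k ω ≤ w k} := fun k =>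
      measurableSet_le (hN.measurable_interarrival k) measurable_const
    rw [lintegral_map (Finset.measurable_prod _ fun k _ => hQm _ (hE k)) hup]
    have h1 := hκ univ _ MeasurableSet.univ (MeasurableSet.iInter hE)
    simp only [preimage_univ, univ_inter, preimage_id, Measure.restrict_univ] at h1
    rw [h1]
    refine lintegral_congr_ae ?_
    filter_upwards [hlaw] with θ hθ
    have h2 := (hN.iIndepFun_interarrival hθ.1 hθ.2).1.precomp (Fin.val_injective (n := r))
    exact h2.meas_iInter fun k => ⟨Iic (w k), measurableSet_Iic, rfl⟩
  · have harr : Measurable fun ω => fun k => arrival N k ω :=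
      measurable_pi_lambda _ hN.measurable_arrival
    -- Exponential interarrival times are encoded by countably many identities. This makes `G`
    -- measurable for the generated σ-algebra, as needed to transfer the almost sure statement to
    -- the image measure `ν`.
    let G : Set (ULift.{v} ℝ) := {y | ∀ l : List (ℚ × ℕ), (∀ p ∈ l, 0 < p.1) →
      Q y {ω | (fun k => arrival N k ω) ∈ counts 0 0 (ratList l)} =
        ENNReal.ofReal (listWeight (α y) (ratList l))}
    have hG : MeasurableSet G := by
      simp only [G, ofPred_forall]
      refine MeasurableSet.iInter fun l => MeasurableSet.iInter fun _ => ?_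
      exact measurableSet_eq_fun (hQm _ (harr (measurableSet_counts _ _ _)))
        ((measurable_listWeight _).comp hα).ennreal_ofReal
    have hGae : ∀ᵐ y ∂ν, y ∈ G := by
      refine (ae_map_iff hup.aemeasurable (p := fun y => y ∈ G) hG).2 ?_
      filter_upwards [hlaw, hαeq] with θ hθ hαθ l hl
      rw [hαθ, ← expSeq_counts hθ.1 _ fun p hp => (ratList_pos hl p hp).le, ← hθ.2,
        hN.map_interSeq_counts]
    filter_upwards [hGae] with y hy
    have hprob : IsProbabilityMeasure (Q y) := inferInstanceAs (IsProbabilityMeasure (κ y.down))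
    refine hN.iIndepFun_interarrival (hαpos y) ?_
    rw [← mixLaw_dirac (hαpos y)]
    refine hN.map_interSeq_eq_mixLaw (Q y) (by simp [hαpos y]) fun l hl => ?_
    rw [lintegral_dirac, hy l hl]

/-- A process which is a Poisson process under the conditional probabilities given `Θ` is a mixed
Poisson process with mixing parameter `Θ`. -/
theorem isMPPParameter_of_disintegrates [IsProbabilityMeasure P] (hN : IsCountingProcess N)
    {Θ : Ω → ℝ} (hΘ : Measurable Θ) {κ : Kernel ℝ Ω} [IsMarkovKernel κ]
    (hκ : Disintegrates P Θ id κ) (hpois : ∀ᵐ θ ∂(P.map Θ), IsPoissonProcess (κ θ) N θ) :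
    IsMPPParameter P N Θ where
  measurable := hΘ
  pos := by
    have := Measure.isProbabilityMeasure_map (μ := P) hΘ.aemeasurable
    refine (mem_ae_iff_prob_eq_one measurableSet_Ioi).1 ?_
    filter_upwards [hpois] with θ hθ using hθ.pos
  cond_indep m t ht s x := by
    have hm : ∀ j, MeasurableSet {ω | increments N t 0 ω j ≤ x j} := fun j =>
      measurableSet_le ((measurable_pi_apply j).comp (hN.measurable_increments t 0))
        measurable_const
    have h1 := hκ.condProb_ae_eq hΘ measurable_id (Finset.measurableSet_biInter s fun j _ => hm j)
    have h2 : ∀ᵐ ω ∂P, ∀ j, (P⟦{ω | increments N t 0 ω j ≤ x j} | sigmaOf Θ⟧) ω =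
        (κ (Θ ω)).real {ω | increments N t 0 ω j ≤ x j} :=
      ae_all_iff.2 fun j => hκ.condProb_ae_eq hΘ measurable_id (hm j)
    rw [preimage_id] at h1
    filter_upwards [h1, h2, ae_of_ae_map hΘ.aemeasurable hpois] with ω h1 h2 h3
    rw [h1, Finset.prod_congr rfl fun j _ => h2 j, measureReal_def,
      (h3.indep m t ht).meas_biInter (s := fun j => {ω | increments N t 0 ω j ≤ x j})
        fun j _ => ⟨Iic (x j), measurableSet_Iic, rfl⟩,
      ENNReal.toReal_prod]
    rfl
  cond_stationary m t ht s hs := by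
    rintro _ ⟨C, hC, rfl⟩ B hB
    have h1 := hκ C _ hC (hN.measurable_increments t s hB)
    have h2 := hκ C _ hC (hN.measurable_increments t 0 hB)
    rw [preimage_id] at h1 h2
    rw [h1, h2]
    refine setLIntegral_congr_fun_ae hC ?_
    filter_upwards [hpois] with θ hθ _
    rw [← Measure.map_apply (hN.measurable_increments t s) hB,
      ← Measure.map_apply (hN.measurable_increments t 0) hB, hθ.stationary m t ht s hs]
  cond_law t ht B hB := by
    filter_upwards [hκ.condProb_ae_eq hΘ measurable_id (hN.measurable t hB),
      ae_of_ae_map hΘ.aemeasurable hpois] with ω h1 h2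
    rw [preimage_id] at h1
    rw [h1, measureReal_def, ← Measure.map_apply (hN.measurable t) hB, h2.law t ht,
      measureReal_def]

theorem HasPoissonDisintegration.hasMixingParameter [IsProbabilityMeasure P]
    (hN : IsCountingProcess N) (h : HasPoissonDisintegration P N) : HasMixingParameter P N := by
  obtain ⟨Θ, Q, hΘ, hQ, hc, hpois⟩ := h
  have := hQ.isMarkovKernel
  exact ⟨Θ, isMPPParameter_of_disintegrates hN hΘ (hQ.disintegrates hΘ hc) hpois⟩

theorem HasPoissonIncrements.hasPoissonDisintegration [IsProbabilityMeasure P]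
    (hN : IsCountingProcess N) (hP : IsPerfect P) (hcg : MeasurableSpace.CountablyGenerated Ω)
    {Θ : Ω → ℝ} (h : HasPoissonIncrements P N Θ) : HasPoissonDisintegration P N := by
  obtain ⟨κ, hκ, hdis⟩ := hP.exists_disintegrates hcg h.measurable
  refine ⟨Θ, fun θ => κ θ, h.measurable, hdis.isDisintegration, hdis.isConsistent h.measurable, ?_⟩
  filter_upwards [h.ae_map_interSeq hN hdis] with θ hθ using hN.isPoissonProcess hθ.1 hθ.2

theorem HasMixingParameter.hasMixingFamily [IsProbabilityMeasure P] (hN : IsCountingProcess N)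
    (hP : IsPerfect P) (hcg : MeasurableSpace.CountablyGenerated Ω) (h : HasMixingParameter P N) :
    HasMixingFamily.{u, v} P N := by
  obtain ⟨Θ, h⟩ := h
  have h := h.hasPoissonIncrements hN
  obtain ⟨κ, hκ, hdis⟩ := hP.exists_disintegrates hcg h.measurable
  exact hasMixingFamily_of_disintegrates hN h.measurable hdis (h.ae_map_interSeq hN hdis)

/-- Common end of the implications from (ii) and from (iv), both of which provide the law of the
interarrival times. The mixing parameter obtained is a function of the given one, so a new
disintegration over its law is taken, by perfectness. -/
theorem RenewalAssumption.hasPoissonDisintegration [IsProbabilityMeasure P]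
    (hN : IsCountingProcess N) (hP : IsPerfect P) (hcg : MeasurableSpace.CountablyGenerated Ω)
    (hA : RenewalAssumption P N) {U : Measure ℝ} [IsProbabilityMeasure U] (hU : U (Ioi 0) = 1)
    (hlaw : P.map (interSeq N) = mixLaw U) : HasPoissonDisintegration P N := by
  obtain ⟨D, Θ, h, K, R, -, hR, hdis, hc, -⟩ := hA
  have := hdis.isMarkovKernel
  obtain ⟨Θ', hΘ'⟩ := hR.exists_hasPoissonIncrements hN
    (hdis.disintegrates hR.measurable_param hc) hU hlaw
  exact hΘ'.hasPoissonDisintegration hN hP hcg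

end MixedPoisson

/-! ### Assembling the theorem -/

theorem theorem2p1 {Ω : Type u} [MeasurableSpace Ω] (P : Measure Ω) [IsProbabilityMeasure P]
    (N : ℝ≥0 → Ω → EReal) (hN : MixedPoisson.IsCountingProcess N) :
    ((MixedPoisson.HasPoissonDisintegration P N → MixedPoisson.HasMixingParameter P N) ∧
      (MixedPoisson.HasMixingParameter P N → MixedPoisson.HasMixingDistribution P N)) ∧
    (MixedPoisson.IsPerfect P → MeasurableSpace.CountablyGenerated Ω →
      ((MixedPoisson.HasMixingParameter P N ↔ MixedPoisson.HasPoissonDisintegration P N) ∧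
        (MixedPoisson.HasMixingParameter P N → MixedPoisson.HasMixingFamily.{u, v} P N)) ∧
      (MixedPoisson.RenewalAssumption P N →
        [MixedPoisson.HasMixingParameter P N, MixedPoisson.HasMixingFamily.{u, v} P N,
          MixedPoisson.HasPoissonDisintegration P N,
          MixedPoisson.HasMixingDistribution P N].TFAE)) := by
  have h31 : MixedPoisson.HasPoissonDisintegration P N → MixedPoisson.HasMixingParameter P N :=
    fun h => h.hasMixingParameter hN
  have h14 : MixedPoisson.HasMixingParameter P N → MixedPoisson.HasMixingDistribution P N :=
    fun ⟨_, h⟩ => ⟨_, (h.hasPoissonIncrements hN).isMPPDistribution⟩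
  refine ⟨⟨h31, h14⟩, fun hP hcg => ?_⟩
  have h13 : MixedPoisson.HasMixingParameter P N → MixedPoisson.HasPoissonDisintegration P N :=
    fun ⟨_, h⟩ => (h.hasPoissonIncrements hN).hasPoissonDisintegration hN hP hcg
  have h12 : MixedPoisson.HasMixingParameter P N → MixedPoisson.HasMixingFamily.{u, v} P N :=
    fun h => h.hasMixingFamily hN hP hcg
  refine ⟨⟨⟨h13, h31⟩, h12⟩, fun hA => ?_⟩
  have h23 : MixedPoisson.HasMixingFamily.{u, v} P N →
      MixedPoisson.HasPoissonDisintegration P N := by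
    rintro ⟨Y, Q, ν, h⟩
    obtain ⟨U, hU, hU0, hlaw⟩ := h.exists_map_interSeq hN
    exact hA.hasPoissonDisintegration hN hP hcg hU0 hlaw
  have h43 : MixedPoisson.HasMixingDistribution P N →
      MixedPoisson.HasPoissonDisintegration P N := by
    rintro ⟨U, h⟩
    have := h.prob
    exact hA.hasPoissonDisintegration hN hP hcg h.pos (h.map_interSeq hN)
  tfae_have 1 → 2 := h12
  tfae_have 2 → 3 := h23
  tfae_have 3 → 1 := h31
  tfae_have 1 → 4 := h14
  tfae_have 4 → 3 := h43
  tfae_finish
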